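/- **Definitions.** All graphs are finite and simple. A connected graph $\Gamma$ with vertex set $V$ and shortest path metric $d$ is *modular* if every three vertices $p_1,p_2,p_3$ have a median, i.e. a vertex $m$ with $d(p_i,p_j)=d(p_i,m)+d(m,p_j)$ for all $i<j$. An orientation $o$ of $\Gamma$ (write $p\swarrow q$ if the edge $pq$ is oriented from $q$ to $p$) is *admissible* if for every 4-cycle $(u,v,v',u')$ one has $u\swarrow v\iff u'\swarrow v'$. A function $h$ on the edges is *orbit-invariant* if it takes equal values on opposite edges of every 4-cycle. A *modular complex* $\mathbf\Gamma=(\Gamma,o,h)$ consists of a modular graph $\Gamma$, an admissible orientation $o$ of it, and a positive real-valued orbit-invariant function $h$ on its edges. Let $\preceq$ be the reflexive transitive closure of $\swarrow$. A pair $(p,q)$ of vertices is *Boolean*, written $p\sqsubseteq q$, if $p$ and $q$ are the minimum and the maximum of a cube subgraph of $\Gamma$, which $o$ orients as the Hasse diagram of a Boolean lattice; $(p,p)$ is Boolean. Put $\mathcal L_p^+=\{q\in V: p\sqsubseteq q\}$ and $\mathcal L_p^-=\{q\in V: q\sqsubseteq p\}$. The *2-subdivision* $\mathbf\Gamma^*=(\Gamma^*,o^*,h^*)$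 has the Boolean pairs as vertices, $(p,q)$ being written $q/p$. The pairs $q/p$ and $q'/p'$ are adjacent if $p=p'$ and $qq'$ is an edge of $\Gamma$, the length $h^*$ being $h(qq')/2$, or if $q=q'$ and $pp'$ is an edge of $\Gamma$, the length being $h(pp')/2$. One has $q/p\swarrow_{o^*}q'/p'$ if $p=p'$ and $q\swarrow q'$, or if $q=q'$ and $p'\swarrow p$. The *neighborhood semilattice* of $p$ is $\mathcal L_p^*=\mathcal L^+_{p/p}(\mathbf\Gamma^*)$, ordered by the relation $\preceq$ of $\mathbf\Gamma^*$, with valuation $v_p^*(x)=d_{\Gamma^*,h^*}(x,p/p)$, where $d_{\Gamma^*,h^*}$ is the shortest path metric of $\Gamma^*$ for the edge-length $h^*$. Let $\mathcal L$ be a finite meet-semilattice with a function $v:\mathcal L\to\mathbb R$, metrized by shortest paths in its covering graph, where the edge from $a$ to a cover $b$ of $a$ has length $v(b)-v(a)$. For $p,q\in\mathcal L$ let $I(p,q)$ be the metric interval, and for $u\in I(p,q)$ put $v(u;p,q)=\bigl(v(u\wedge p)-v(p\wedge q),\,v(u\wedge q)-v(p\wedge q)\bigr)\in\mathbb R^2$.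 Let $\operatorname{Conv}I(p,q)$ be the convex hull of these vectors. The envelope $\mathcal E(p,q)$ is the set of $u\in I(p,q)$ such that $z=v(u;p,q)$ is an extreme point of $\operatorname{Conv}I(p,q)$ and $z+\epsilon\notin\operatorname{Conv}I(p,q)$ for every $\epsilon$ with both coordinates positive. Let $C(u;p,q)$ be the cone of all $w\in\mathbb R^2_{\ge0}$ with $\langle w,v(u;p,q)\rangle=\max_{u'\in I(p,q)}\langle w,v(u';p,q)\rangle$. For the cone $C\subseteq\mathbb R_{\ge0}^2$ of vectors with angles between $\beta$ and $\alpha$, $0\le\beta\le\alpha\le\pi/2$, put $[C]=\frac{\sin\alpha}{\cos\alpha+\sin\alpha}-\frac{\sin\beta}{\cos\beta+\sin\beta}$, and put $[\{0\}]=0$. A function $f:\mathcal L\to\mathbb R$ is *submodular* (with respect to $v$) if $$f(p)+f(q)\ \ge\ f(p\wedge q)+\sum_{u\in\mathcal E(p,q)}[C(u;p,q)]\,f(u)\qquad(p,q\in\mathcal L).$$ A function $g:V\to\mathbb R$ is *L-convex* on $\mathbf\Gamma$ if for every vertex $p$ the function $q'/q\mapsto\frac{g(q)+g(q')}2$ is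 submodular on $\mathcal L_p^*$ with respect to $v_p^*$. **Theorem (L-optimality criterion).** Let $g$ be an L-convex function on a modular complex $\mathbf\Gamma=(\Gamma,o,h)$ and let $p\in V$. The following conditions are equivalent: 1. $g(p)\le g(q)$ for every $q\in V$. 2. $g(p)\le g(q)$ for every $q\in V$ with $p\sqsubseteq q$ or $q\sqsubseteq p$. 3. $g(p)=\min\{g(q): q\in\mathcal L_p^+\}=\min\{g(q): q\in\mathcal L_p^-\}$. -/

import Mathlib

/-! ### Shortest-path metrics, modular graphs, orbits -/

/-- The length of a walk for an edge-length `len` (only the values of `len` on edges matter). -/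
def SimpleGraph.Walk.weight {V : Type*} {G : SimpleGraph V} (len : Sym2 V → ℝ) {p q : V}
    (w : G.Walk p q) : ℝ :=
  (w.edges.map len).sum

/-- The shortest path metric of `G` for the edge-length `len`. -/
noncomputable def SimpleGraph.weightedDist {V : Type*} (G : SimpleGraph V) (len : Sym2 V → ℝ)
    (p q : V) : ℝ :=
  ⨅ w : G.Walk p q, w.weight len

/-- The vertices `u`, `v`, `v'`, `u'`, in this cyclic order, form a 4-cycle. -/
def SimpleGraph.IsFourCycle {V : Type*} (G : SimpleGraph V) (u v v' u' : V) : Prop :=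
  G.Adj u v ∧ G.Adj v v' ∧ G.Adj v' u' ∧ G.Adj u' u ∧ u ≠ v' ∧ v ≠ u'

/-- A connected graph is modular if every triple of vertices has a median. -/
def SimpleGraph.IsModular {V : Type*} (G : SimpleGraph V) : Prop :=
  G.Connected ∧ ∀ p₁ p₂ p₃ : V, ∃ m : V,
    G.dist p₁ m + G.dist m p₂ = G.dist p₁ p₂ ∧
    G.dist p₂ m + G.dist m p₃ = G.dist p₂ p₃ ∧
    G.dist p₃ m + G.dist m p₁ = G.dist p₃ p₁

/-- Two edges lie on a common 4-cycle and share no vertex. -/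
def SimpleGraph.OppositeEdges {V : Type*} (G : SimpleGraph V) (e e' : Sym2 V) : Prop :=
  ∃ u v v' u' : V, G.IsFourCycle u v v' u' ∧ e = s(u, v) ∧ e' = s(u', v')

/-- Two edges are projective if they are joined by a sequence of edges in which consecutive
edges are opposite in a 4-cycle. The classes of this relation are the orbits. -/
def SimpleGraph.Projective {V : Type*} (G : SimpleGraph V) : Sym2 V → Sym2 V → Prop :=
  Relation.ReflTransGen G.OppositeEdges

/-- `len` is constant on each orbit of edges. -/
def SimpleGraph.IsOrbitInvariant {V : Type*} (G : SimpleGraph V) (len : Sym2 V → ℝ) : Prop :=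
  ∀ e ∈ G.edgeSet, ∀ e' ∈ G.edgeSet, G.Projective e e' → len e = len e'

/-! ### Submodular functions with respect to a valuation

The notions below are used for modular semilattices. The order is only required to be a preorder
here: for the orders to which the notions are applied, antisymmetry and the existence of meets are
theorems and not part of the definitions. -/

section Submodular

variable {L : Type*} [Preorder L]

open Classical in
/-- The meet (greatest lower bound) of two elements. -/
noncomputable def semilatticeMeet (a b : L) : L :=
  if h : ∃ m, IsGLB {a, b} m then h.choose else a

/-- The edge-length on the covering graph induced by a valuation `v`: the edge between `a` and `b`,
where `b` covers `a`, has length `v b - v a`. -/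
def valuationLength (v : L → ℝ) : Sym2 L → ℝ :=
  Sym2.lift ⟨fun a b => |v b - v a|, fun a b => abs_sub_comm (v b) (v a)⟩

/-- The metric on `L`: shortest paths in the covering graph. -/
noncomputable def semilatticeDist (v : L → ℝ) (a b : L) : ℝ :=
  (SimpleGraph.hasse L).weightedDist (valuationLength v) a b

/-- The metric interval `I(p, q)` in `L`. -/
def metricInterval (v : L → ℝ) (p q : L) : Set L :=
  {u | semilatticeDist v p u + semilatticeDist v u q = semilatticeDist v p q}

/-- The vector `v(u; p, q) = (v[p ∧ q, u ∧ p], v[p ∧ q, u ∧ q])` of the plane, where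
`v[a, b] = v b - v a`. -/
noncomputable def planeVector (v : L → ℝ) (p q u : L) : ℝ × ℝ :=
  (v (semilatticeMeet u p) - v (semilatticeMeet p q),
    v (semilatticeMeet u q) - v (semilatticeMeet p q))

/-- The polygon `Conv I(p, q)`. -/
noncomputable def intervalHull (v : L → ℝ) (p q : L) : Set (ℝ × ℝ) :=
  convexHull ℝ (planeVector v p q '' metricInterval v p q)

/-- The `(p, q)`-envelope: the elements `u` of `I(p, q)` whose vector is a maximal extreme point of
`Conv I(p, q)`, that is, an extreme point `z` such that `z + ε` is outside `Conv I(p, q)` for every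
vector `ε` with both coordinates positive. -/
def envelope (v : L → ℝ) (p q : L) : Set L :=
  {u | u ∈ metricInterval v p q ∧
    planeVector v p q u ∈ (intervalHull v p q).extremePoints ℝ ∧
    ∀ ε : ℝ × ℝ, 0 < ε.1 → 0 < ε.2 → planeVector v p q u + ε ∉ intervalHull v p q}

/-- The cone `C(u; p, q)` of the nonnegative vectors `w` for which `u` maximizes
`⟨w, v(·; p, q)⟩` over `I(p, q)`. -/
def normalCone (v : L → ℝ) (p q u : L) : Set (ℝ × ℝ) :=
  {w | 0 ≤ w.1 ∧ 0 ≤ w.2 ∧ ∀ u' ∈ metricInterval v p q,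
    w.1 * (planeVector v p q u').1 + w.2 * (planeVector v p q u').2 ≤
      w.1 * (planeVector v p q u).1 + w.2 * (planeVector v p q u).2}

/-- The closed convex cone of the nonnegative quadrant between the angles `β` and `α`. -/
def angularCone (α β : ℝ) : Set (ℝ × ℝ) :=
  {z | 0 ≤ z.1 ∧ 0 ≤ z.2 ∧
    -z.1 * Real.sin α + z.2 * Real.cos α ≤ 0 ∧ 0 ≤ -z.1 * Real.sin β + z.2 * Real.cos β}

open Classical in
/-- The value `[C]` of a closed convex cone `C` in the nonnegative quadrant. A cone other than `{0}`
is `angularCone α β` for unique `0 ≤ β ≤ α ≤ π / 2`; the cone `{0}` is not of this form and has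
value `0`. -/
noncomputable def coneValue (C : Set (ℝ × ℝ)) : ℝ :=
  if h : ∃ θ : ℝ × ℝ, 0 ≤ θ.2 ∧ θ.2 ≤ θ.1 ∧ θ.1 ≤ Real.pi / 2 ∧ C = angularCone θ.1 θ.2 then
    Real.sin h.choose.1 / (Real.cos h.choose.1 + Real.sin h.choose.1) -
      Real.sin h.choose.2 / (Real.cos h.choose.2 + Real.sin h.choose.2)
  else 0

/-- A (finite-valued) function `f` is submodular with respect to the valuation `v`; the sum is the
value of `f` at the fractional join of `p` and `q`. -/
def IsSubmodular (v f : L → ℝ) : Prop :=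
  ∀ p q : L, f (semilatticeMeet p q) +
      ∑ᶠ u ∈ envelope v p q, coneValue (normalCone v p q u) * f u ≤ f p + f q

end Submodular

/-! ### Modular complexes -/

/-- A simple graph with an orientation and an edge-length. `below p q` (written `p ↙ q`) means that
`pq` is an edge oriented from `q` to `p`. Only the values of `len` on edges matter. -/
structure OrientedLengthGraph (V : Type*) where
  graph : SimpleGraph V
  below : V → V → Prop
  adj_iff : ∀ p q, graph.Adj p q ↔ below p q ∨ below q p
  asymm : ∀ p q, below p q → ¬ below q p
  len : Sym2 V → ℝ

namespace OrientedLengthGraph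

variable {V : Type*} (Γ : OrientedLengthGraph V)

/-- Opposite edges of every 4-cycle are oriented in the same direction. -/
def IsAdmissible : Prop :=
  ∀ u v v' u' : V, Γ.graph.IsFourCycle u v v' u' → (Γ.below u v ↔ Γ.below u' v')

/-- `(Γ, o, h)` is a modular complex: `Γ` is a modular graph, `o` is an admissible orientation,
and `h` is a positive orbit-invariant function on the edges. -/
structure IsModularComplex : Prop where
  modular : Γ.graph.IsModular
  admissible : Γ.IsAdmissible
  pos : ∀ e ∈ Γ.graph.edgeSet, 0 < Γ.len e
  orbitInvariant : Γ.graph.IsOrbitInvariant Γ.len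

/-- The relation `⪯`: the reflexive transitive closure of `↙`. -/
def Precedes : V → V → Prop := Relation.ReflTransGen Γ.below

/-- `(p, q)` is a Boolean pair (`p ⊑ q`): some cube subgraph, with its orientation, is the Hasse
diagram of the Boolean lattice of all subsets of `{1, …, n}`, with minimum `p` and maximum `q`.
The case `n = 0` is the pair `(p, p)`. -/
def IsBoolean (p q : V) : Prop :=
  ∃ (n : ℕ) (φ : Finset (Fin n) ↪ V),
    (∀ (S : Finset (Fin n)) (i : Fin n), i ∉ S → Γ.below (φ S) (φ (insert i S))) ∧
    φ ∅ = p ∧ φ Finset.univ = q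

/-- `ℒ⁺_p`. -/
def upper (p : V) : Set V := {q | Γ.IsBoolean p q}

/-- `ℒ⁻_p`. -/
def lower (p : V) : Set V := {q | Γ.IsBoolean q p}

/-- The set of Boolean pairs; the pair `(p, q)` with `p = lo` and `q = hi` is written `q/p`. -/
@[ext]
structure BooleanPair where
  lo : V
  hi : V
  isBoolean : Γ.IsBoolean lo hi

/-- Every `(p, p)` is a Boolean pair. -/
theorem isBoolean_self (p : V) : Γ.IsBoolean p p :=
  ⟨0, ⟨fun _ => p, fun _ _ _ => Subsingleton.elim _ _⟩, fun _ i => i.elim0, rfl, rfl⟩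

/-- The pair `p/p`. -/
def diag (p : V) : Γ.BooleanPair := ⟨p, p, Γ.isBoolean_self p⟩

theorem below_ne {p q : V} (h : Γ.below p q) : p ≠ q := by
  rintro rfl
  exact Γ.asymm _ _ h h

open Classical in
/-- The 2-subdivision `Γ* = (Γ*, o*, h*)`, a graph on the set of Boolean pairs. -/
noncomputable def subdivision : OrientedLengthGraph Γ.BooleanPair where
  graph :=
    { Adj := fun a b => (a.lo = b.lo ∧ Γ.graph.Adj a.hi b.hi) ∨
        (a.hi = b.hi ∧ Γ.graph.Adj a.lo b.lo)
      symm := ⟨by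
        rintro a b (⟨h, h'⟩ | ⟨h, h'⟩)
        · exact Or.inl ⟨h.symm, h'.symm⟩
        · exact Or.inr ⟨h.symm, h'.symm⟩⟩
      loopless := ⟨by
        rintro a (⟨_, h⟩ | ⟨_, h⟩)
        · exact h.ne rfl
        · exact h.ne rfl⟩ }
  below := fun a b => (a.lo = b.lo ∧ Γ.below a.hi b.hi) ∨ (a.hi = b.hi ∧ Γ.below b.lo a.lo)
  adj_iff := by
    intro a b
    simp only [Γ.adj_iff, eq_comm (a := b.lo), eq_comm (a := b.hi)]
    tauto
  asymm := by
    rintro a b (⟨h, h'⟩ | ⟨h, h'⟩) (⟨k, k'⟩ | ⟨k, k'⟩)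
    · exact Γ.asymm _ _ h' k'
    · exact Γ.below_ne h' k.symm
    · exact Γ.below_ne h' k
    · exact Γ.asymm _ _ h' k'
  len := Sym2.lift
    ⟨fun a b => if a.lo = b.lo then Γ.len s(a.hi, b.hi) / 2 else Γ.len s(a.lo, b.lo) / 2, by
      intro a b
      simp only [eq_comm (a := a.lo), Sym2.eq_swap (a := a.lo), Sym2.eq_swap (a := a.hi)]⟩

/-- The neighborhood semilattice `ℒ*_p = ℒ⁺_{p/p}(Γ*)`. -/
def NeighborhoodSemilattice (p : V) : Type _ := ↥(Γ.subdivision.upper (Γ.diag p))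

/-- `ℒ*_p` is ordered by the relation `⪯` of `Γ*`. -/
instance (p : V) : Preorder (Γ.NeighborhoodSemilattice p) where
  le x y := Γ.subdivision.Precedes x.1 y.1
  le_refl _ := Relation.ReflTransGen.refl
  le_trans _ _ _ h h' := Relation.ReflTransGen.trans h h'

/-- The valuation of `ℒ*_p`: the distance from `p/p` in `Γ*` for the edge-length `h*`. -/
noncomputable def neighborhoodValuation (p : V) (x : Γ.NeighborhoodSemilattice p) : ℝ :=
  Γ.subdivision.graph.weightedDist Γ.subdivision.len x.1 (Γ.diag p)

/-- The extension of a function on the vertices to the Boolean pairs. -/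
noncomputable def extend (g : V → ℝ) (a : Γ.BooleanPair) : ℝ := (g a.lo + g a.hi) / 2

/-- `g` is L-convex: for every vertex `p`, the restriction of its extension to `ℒ*_p` is
submodular. -/
def IsLConvex (g : V → ℝ) : Prop :=
  ∀ p : V, IsSubmodular (Γ.neighborhoodValuation p)
    (fun x : Γ.NeighborhoodSemilattice p => Γ.extend g x.1)

end OrientedLengthGraph

/-! Cutting a planar cone by the segment from (1,0) to (0,1) turns its value `[C]` into the length
of a slice. The slices of the normal cones of the envelope overlap in null sets and cover [0,1] up
to finitely many points, so the coefficients in the submodular inequality add up to one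
(`sum_coneValue_envelope`). Submodularity thus compares f(x) + f(y) with the value at the meet plus
an average over the envelope. Hence if f(x) ≤ α, f(y) < α and x, y are incomparable, a third element
of their interval has value below α, and induction on the distance joins x to y through comparable
elements with values below α (`reflTransGen_comparable`).

Applied to ℒ*_r with α = g(r), this lets a path of Boolean-comparable vertices bypass a peak r
strictly below the level g(r) (`reflTransGen_avoid`). Suppose g(q) < g(p), and take the least level
at which q reaches p by Boolean-comparable steps. Bypassing peaks lowers this level unless it equals
g(p), and in that case p is comparable to a vertex with smaller value. So a local minimum is global.

The argument needs ℒ*_r to be a meet-semilattice with a strictly increasing modular valuation in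
which pairwise bounded triples are bounded (`isModularValuation`). This is derived from Γ alone,
without modularity of Γ*: medians are meets, principal filters are convex, and (p, q) is Boolean
exactly when q is a join of covers of p (`isBoolean_iff_isAtomJoin`). The last description makes
Boolean pairs hereditary and closed under joins; reversing the orientation gives the dual
statements. -/

open MeasureTheory

/-! ### Values of cones as lengths of slices -/

/-- The trace of a planar cone on the segment from `(1, 0)` to `(0, 1)`. -/
def coneSlice (C : Set (ℝ × ℝ)) : Set ℝ :=
  {t | t ∈ Set.Icc (0 : ℝ) 1 ∧ ((1 - t, t) : ℝ × ℝ) ∈ C}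

/-- The parameter on the segment from `(1, 0)` to `(0, 1)` of the ray of angle `θ`. -/
noncomputable def angleParam (θ : ℝ) : ℝ := Real.sin θ / (Real.cos θ + Real.sin θ)

theorem cos_add_sin_pos {θ : ℝ} (h0 : 0 ≤ θ) (h1 : θ ≤ Real.pi / 2) :
    0 < Real.cos θ + Real.sin θ := by
  have hc : 0 ≤ Real.cos θ := Real.cos_nonneg_of_mem_Icc ⟨by linarith, h1⟩
  have hs : 0 ≤ Real.sin θ := Real.sin_nonneg_of_nonneg_of_le_pi h0 (by linarith [Real.pi_pos])
  nlinarith [Real.sin_sq_add_cos_sq θ]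

/-- After cross-multiplication the difference of the two sides is sin(β - α). -/
theorem angleParam_lt_angleParam {α β : ℝ} (h0 : 0 ≤ α) (h : α < β) (h1 : β ≤ Real.pi / 2) :
    angleParam α < angleParam β := by
  have ha := cos_add_sin_pos h0 (h.le.trans h1)
  have hb := cos_add_sin_pos (h0.trans h.le) h1
  have hs : 0 < Real.sin (β - α) :=
    Real.sin_pos_of_pos_of_lt_pi (by linarith) (by linarith [Real.pi_pos])
  rw [Real.sin_sub] at hs
  unfold angleParam
  rw [div_lt_div_iff₀ ha hb]
  nlinarith

theorem angleParam_mem_Icc {θ : ℝ} (h0 : 0 ≤ θ) (h1 : θ ≤ Real.pi / 2) :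
    angleParam θ ∈ Set.Icc (0 : ℝ) 1 := by
  have hc : 0 ≤ Real.cos θ := Real.cos_nonneg_of_mem_Icc ⟨by linarith, h1⟩
  have hs : 0 ≤ Real.sin θ := Real.sin_nonneg_of_nonneg_of_le_pi h0 (by linarith [Real.pi_pos])
  have hp := cos_add_sin_pos h0 h1
  unfold angleParam
  exact ⟨by positivity, by rw [div_le_one hp]; linarith⟩

theorem exists_angleParam_eq {t : ℝ} (ht : t ∈ Set.Icc (0 : ℝ) 1) :
    ∃ θ, 0 ≤ θ ∧ θ ≤ Real.pi / 2 ∧ angleParam θ = t := by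
  have hpi : (0 : ℝ) ≤ Real.pi / 2 := by positivity
  have hc : ContinuousOn angleParam (Set.Icc 0 (Real.pi / 2)) := by
    unfold angleParam
    refine ContinuousOn.div (by fun_prop) (by fun_prop) fun x hx => ?_
    exact (cos_add_sin_pos hx.1 hx.2).ne'
  have h := intermediate_value_Icc hpi hc
  have h0 : angleParam 0 = 0 := by simp [angleParam]
  have h1 : angleParam (Real.pi / 2) = 1 := by simp [angleParam]
  rw [h0, h1] at h
  obtain ⟨θ, hθ, rfl⟩ := h ht
  exact ⟨θ, hθ.1, hθ.2, rfl⟩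

theorem mem_angularCone_slice {α β t : ℝ} (h0 : 0 ≤ β) (h : β ≤ α) (h1 : α ≤ Real.pi / 2)
    (ht : t ∈ Set.Icc (0 : ℝ) 1) :
    ((1 - t, t) : ℝ × ℝ) ∈ angularCone α β ↔ t ∈ Set.Icc (angleParam β) (angleParam α) := by
  have ha := cos_add_sin_pos (h0.trans h) h1
  have hb := cos_add_sin_pos h0 (h.trans h1)
  simp only [angularCone, angleParam, Set.mem_ofPred_eq, Set.mem_Icc, div_le_iff₀ hb, le_div_iff₀ ha]
  constructor
  · rintro ⟨_, _, h3, h4⟩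
    constructor <;> linarith
  · rintro ⟨h3, h4⟩
    exact ⟨by linarith [ht.2], ht.1, by linarith, by linarith⟩

theorem angleParam_le_angleParam {α β : ℝ} (h0 : 0 ≤ β) (h : β ≤ α) (h1 : α ≤ Real.pi / 2) :
    angleParam β ≤ angleParam α := by
  rcases h.eq_or_lt with rfl | h
  · exact le_rfl
  · exact (angleParam_lt_angleParam h0 h h1).le

theorem coneSlice_angularCone {α β : ℝ} (h0 : 0 ≤ β) (h : β ≤ α) (h1 : α ≤ Real.pi / 2) :
    coneSlice (angularCone α β) = Set.Icc (angleParam β) (angleParam α) := by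
  ext t
  constructor
  · rintro ⟨ht, h'⟩
    exact (mem_angularCone_slice h0 h h1 ht).1 h'
  · intro ht
    have ht' : t ∈ Set.Icc (0 : ℝ) 1 :=
      ⟨(angleParam_mem_Icc h0 (h.trans h1)).1.trans ht.1,
        ht.2.trans (angleParam_mem_Icc (h0.trans h) h1).2⟩
    exact ⟨ht', (mem_angularCone_slice h0 h h1 ht').2 ht⟩

theorem angularCone_smul_iff {α β k : ℝ} (hk : 0 < k) (z : ℝ × ℝ) :
    (k * z.1, k * z.2) ∈ angularCone α β ↔ z ∈ angularCone α β := by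
  simp only [angularCone, Set.mem_ofPred_eq]
  have e1 : -(k * z.1) * Real.sin α + k * z.2 * Real.cos α =
      k * (-z.1 * Real.sin α + z.2 * Real.cos α) := by ring
  have e2 : -(k * z.1) * Real.sin β + k * z.2 * Real.cos β =
      k * (-z.1 * Real.sin β + z.2 * Real.cos β) := by ring
  have e3 (c : ℝ) : k * c ≤ 0 ↔ c ≤ 0 := by
    rw [← neg_nonneg, ← mul_neg, mul_nonneg_iff_of_pos_left hk, neg_nonneg]
  rw [e1, e2, e3, mul_nonneg_iff_of_pos_left hk, mul_nonneg_iff_of_pos_left hk,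
    mul_nonneg_iff_of_pos_left hk]

/-- Two cones of the quadrant (sets closed under scaling) with the same nonempty slice agree. -/
theorem eq_of_coneSlice_eq {C D : Set (ℝ × ℝ)}
    (hC : ∀ z ∈ C, 0 ≤ z.1 ∧ 0 ≤ z.2) (hD : ∀ z ∈ D, 0 ≤ z.1 ∧ 0 ≤ z.2)
    (hC0 : (0, 0) ∈ C) (hD0 : (0, 0) ∈ D)
    (hCs : ∀ k : ℝ, 0 < k → ∀ z : ℝ × ℝ, (k * z.1, k * z.2) ∈ C ↔ z ∈ C)
    (hDs : ∀ k : ℝ, 0 < k → ∀ z : ℝ × ℝ, (k * z.1, k * z.2) ∈ D ↔ z ∈ D)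
    (h : coneSlice C = coneSlice D) : C = D := by
  have key : ∀ z : ℝ × ℝ, 0 ≤ z.1 → 0 ≤ z.2 → (z ∈ C ↔ z ∈ D) := by
    intro z h1 h2
    rcases (add_nonneg h1 h2).eq_or_lt with h0 | h0
    · have : z = (0, 0) := Prod.ext (by simp; linarith) (by simp; linarith)
      simp [this, hC0, hD0]
    · have hk := inv_pos.2 h0
      have e : ((z.1 + z.2)⁻¹ * z.1, (z.1 + z.2)⁻¹ * z.2) =
          ((1 - (z.1 + z.2)⁻¹ * z.2, (z.1 + z.2)⁻¹ * z.2) : ℝ × ℝ) := by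
        ext
        · have := inv_mul_cancel₀ h0.ne'
          simp only
          linarith
        · rfl
      have ht : (z.1 + z.2)⁻¹ * z.2 ∈ Set.Icc (0 : ℝ) 1 :=
        ⟨by positivity, by rw [inv_mul_le_one₀ h0]; linarith⟩
      have h' := Set.ext_iff.1 h ((z.1 + z.2)⁻¹ * z.2)
      simp only [coneSlice, Set.mem_ofPred_eq, ht, true_and, ← e] at h'
      rw [← hCs _ hk, ← hDs _ hk, h']
  ext z
  constructor
  · intro hz
    exact (key z (hC z hz).1 (hC z hz).2).1 hz
  · intro hz
    exact (key z (hD z hz).1 (hD z hz).2).2 hz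

theorem normalCone_smul_iff {L : Type*} [Preorder L] (v : L → ℝ) (p q u : L) (k : ℝ) (hk : 0 < k)
    (z : ℝ × ℝ) : (k * z.1, k * z.2) ∈ normalCone v p q u ↔ z ∈ normalCone v p q u := by
  simp only [normalCone, Set.mem_ofPred_eq, mul_nonneg_iff_of_pos_left hk, mul_assoc, ← mul_add,
    mul_le_mul_iff_right₀ hk]

theorem zero_mem_normalCone {L : Type*} [Preorder L] (v : L → ℝ) (p q u : L) :
    (0, 0) ∈ normalCone v p q u := by
  simp [normalCone]

theorem convex_coneSlice_normalCone {L : Type*} [Preorder L] (v : L → ℝ) (p q u : L) :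
    Convex ℝ (coneSlice (normalCone v p q u)) := by
  intro s hs t ht a b ha hb hab
  obtain ⟨⟨hs0, hs1⟩, -, -, hs⟩ := hs
  obtain ⟨⟨ht0, ht1⟩, -, -, ht⟩ := ht
  obtain rfl : a = 1 - b := by linarith
  simp only [smul_eq_mul] at *
  refine ⟨⟨by positivity, by nlinarith⟩, ?_, ?_, fun u' hu' => ?_⟩
  · show 0 ≤ 1 - _
    nlinarith
  · show (0 : ℝ) ≤ _
    positivity
  · have h1 := mul_le_mul_of_nonneg_left (hs u' hu') ha
    have h2 := mul_le_mul_of_nonneg_left (ht u' hu') hb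
    simp only
    linarith

theorem isClosed_coneSlice_normalCone {L : Type*} [Preorder L] (v : L → ℝ) (p q u : L) :
    IsClosed (coneSlice (normalCone v p q u)) := by
  have : coneSlice (normalCone v p q u) = Set.Icc 0 1 ∩
      ⋂ u' ∈ metricInterval v p q, {t : ℝ |
        (1 - t) * (planeVector v p q u').1 + t * (planeVector v p q u').2 ≤
          (1 - t) * (planeVector v p q u).1 + t * (planeVector v p q u).2} := by
    ext t
    simp only [coneSlice, normalCone, Set.mem_ofPred_eq, Set.mem_inter_iff, Set.mem_iInter,
      Set.mem_Icc]
    constructor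
    · rintro ⟨h, -, -, h'⟩
      exact ⟨h, h'⟩
    · rintro ⟨h, h'⟩
      exact ⟨h, by linarith [h.2], h.1, h'⟩
  rw [this]
  refine isClosed_Icc.inter (isClosed_biInter fun u' _ => ?_)
  exact isClosed_le (by fun_prop) (by fun_prop)

/-- Uniqueness of the angles is not needed: whichever pair is chosen, the slice is the interval
between their parameters, and the formula is its length. -/
theorem coneValue_angularCone {C : Set (ℝ × ℝ)}
    (h : ∃ θ : ℝ × ℝ, 0 ≤ θ.2 ∧ θ.2 ≤ θ.1 ∧ θ.1 ≤ Real.pi / 2 ∧ C = angularCone θ.1 θ.2) :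
    coneValue C = volume.real (coneSlice C) := by
  unfold coneValue
  rw [dif_pos h]
  obtain ⟨h0, h1, h2, h3⟩ := h.choose_spec
  generalize h.choose = θ at *
  subst h3
  rw [coneSlice_angularCone h0 h1 h2, Real.volume_real_Icc_of_le (angleParam_le_angleParam h0 h1 h2)]
  rfl

theorem coneValue_normalCone {L : Type*} [Preorder L] (v : L → ℝ) (p q u : L) :
    coneValue (normalCone v p q u) = volume.real (coneSlice (normalCone v p q u)) := by
  by_cases h : ∃ θ : ℝ × ℝ, 0 ≤ θ.2 ∧ θ.2 ≤ θ.1 ∧ θ.1 ≤ Real.pi / 2 ∧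
      normalCone v p q u = angularCone θ.1 θ.2
  · exact coneValue_angularCone h
  -- A nonempty slice is a compact interval whose endpoints supply two angles, and the cone is
  -- recovered from its slice. So the default value 0 is used only for an empty slice.
  · have hempty : coneSlice (normalCone v p q u) = ∅ := by
      rw [← Set.not_nonempty_iff_eq_empty]
      intro hne
      apply h
      have hI := eq_Icc_of_connected_compact
        ⟨hne, (convex_coneSlice_normalCone v p q u).isPreconnected⟩
        (Metric.isCompact_of_isClosed_isBounded (isClosed_coneSlice_normalCone v p q u)
          (Metric.isBounded_Icc 0 1 |>.subset fun t ht => ht.1))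
      set s := sInf (coneSlice (normalCone v p q u))
      set t := sSup (coneSlice (normalCone v p q u))
      have hst : s ≤ t := by
        rw [hI] at hne
        exact Set.nonempty_Icc.1 hne
      have hs : s ∈ Set.Icc (0 : ℝ) 1 := by
        have : s ∈ coneSlice (normalCone v p q u) := by rw [hI]; exact ⟨le_rfl, hst⟩
        exact this.1
      have ht : t ∈ Set.Icc (0 : ℝ) 1 := by
        have : t ∈ coneSlice (normalCone v p q u) := by rw [hI]; exact ⟨hst, le_rfl⟩
        exact this.1
      obtain ⟨β, hβ0, hβ1, hβ⟩ := exists_angleParam_eq hs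
      obtain ⟨α, hα0, hα1, hα⟩ := exists_angleParam_eq ht
      have hab : β ≤ α := by
        by_contra! hlt
        have := angleParam_lt_angleParam hα0 hlt hβ1
        linarith
      refine ⟨(α, β), hβ0, hab, hα1, ?_⟩
      refine eq_of_coneSlice_eq (fun z hz => ⟨hz.1, hz.2.1⟩) (fun z hz => ⟨hz.1, hz.2.1⟩)
        (zero_mem_normalCone v p q u) (by simp [angularCone]) (normalCone_smul_iff v p q u)
        (fun k hk => angularCone_smul_iff hk) ?_
      rw [coneSlice_angularCone hβ0 hab hα1, hI, hβ, hα]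
    unfold coneValue
    rw [dif_neg h, hempty]
    simp

/-! ### Maximal vertices of planar polygons -/

/-- An open half-plane with one boundary point added stays convex. Used in place of the closed
half-plane, it shows that a strict maximizer on a set remains the only maximizer on its convex hull.
-/
theorem convex_insert_halfSpace (w z : ℝ × ℝ) :
    Convex ℝ {x : ℝ × ℝ | x = z ∨ w.1 * x.1 + w.2 * x.2 < w.1 * z.1 + w.2 * z.2} := by
  rw [convex_iff_openSegment_subset]
  rintro x hx y hy _ ⟨a, b, ha, hb, hab, rfl⟩
  obtain rfl : a = 1 - b := by linarith
  have aux : ∀ c d : ℝ, c ≤ w.1 * z.1 + w.2 * z.2 → d ≤ w.1 * z.1 + w.2 * z.2 →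
      (c < w.1 * z.1 + w.2 * z.2 ∨ d < w.1 * z.1 + w.2 * z.2) →
      (1 - b) * c + b * d < w.1 * z.1 + w.2 * z.2 := by
    rintro c d hc hd (h | h) <;> nlinarith
  by_cases hxz : x = z
  · by_cases hyz : y = z
    · left
      rw [hxz, hyz, ← add_smul, sub_add_cancel, one_smul]
    · right
      have := aux _ _ (show w.1 * x.1 + w.2 * x.2 ≤ _ by rw [hxz]) (hy.resolve_left hyz).le
        (Or.inr (hy.resolve_left hyz))
      simp only [Prod.fst_add, Prod.smul_fst, Prod.snd_add, Prod.smul_snd, smul_eq_mul]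
      linarith
  · right
    have hx' := hx.resolve_left hxz
    have hy' : w.1 * y.1 + w.2 * y.2 ≤ w.1 * z.1 + w.2 * z.2 := by
      rcases hy with rfl | hy
      · rfl
      · exact hy.le
    have := aux _ _ hx'.le hy' (Or.inl hx')
    simp only [Prod.fst_add, Prod.smul_fst, Prod.snd_add, Prod.smul_snd, smul_eq_mul]
    linarith

theorem convexHull_subset_insert_halfSpace {P : Set (ℝ × ℝ)} {w z : ℝ × ℝ}
    (h : ∀ x ∈ P, x = z ∨ w.1 * x.1 + w.2 * x.2 < w.1 * z.1 + w.2 * z.2) :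
    convexHull ℝ P ⊆ {x | x = z ∨ w.1 * x.1 + w.2 * x.2 < w.1 * z.1 + w.2 * z.2} :=
  convexHull_min h (convex_insert_halfSpace w z)

theorem mem_extremePoints_of_forall_lt {P : Set (ℝ × ℝ)} {w z : ℝ × ℝ} (hz : z ∈ P)
    (h : ∀ x ∈ P, x = z ∨ w.1 * x.1 + w.2 * x.2 < w.1 * z.1 + w.2 * z.2) :
    z ∈ (convexHull ℝ P).extremePoints ℝ := by
  have hsub := convexHull_subset_insert_halfSpace h
  rw [mem_extremePoints_iff_left]
  refine ⟨subset_convexHull ℝ P hz, ?_⟩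
  rintro x hx y hy ⟨a, b, ha, hb, hab, he⟩
  by_contra hxz
  have hx' := (hsub hx).resolve_left hxz
  have hy' : w.1 * y.1 + w.2 * y.2 ≤ w.1 * z.1 + w.2 * z.2 := by
    rcases hsub hy with rfl | hy
    · rfl
    · exact hy.le
  obtain rfl : a = 1 - b := by linarith
  have e1 : (1 - b) * x.1 + b * y.1 = z.1 := by rw [← he]; simp
  have e2 : (1 - b) * x.2 + b * y.2 = z.2 := by rw [← he]; simp
  have h1 := mul_lt_mul_of_pos_left hx' ha
  have h2 := mul_le_mul_of_nonneg_left hy' hb.le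
  have h3 : w.1 * z.1 + w.2 * z.2 = (1 - b) * (w.1 * x.1 + w.2 * x.2) +
    b * (w.1 * y.1 + w.2 * y.2) := by rw [← e1, ← e2]; ring
  linarith

theorem add_notMem_convexHull_of_forall_lt {P : Set (ℝ × ℝ)} {w z : ℝ × ℝ}
    (hw1 : 0 < w.1) (hw2 : 0 < w.2)
    (h : ∀ x ∈ P, x = z ∨ w.1 * x.1 + w.2 * x.2 < w.1 * z.1 + w.2 * z.2)
    (ε : ℝ × ℝ) (h1 : 0 < ε.1) (h2 : 0 < ε.2) : z + ε ∉ convexHull ℝ P := by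
  intro hmem
  rcases convexHull_subset_insert_halfSpace h hmem with h' | h'
  · have : ε = 0 := by simpa using h'
    simp [this] at h1
  · simp only [Prod.fst_add, Prod.snd_add] at h'
    nlinarith [mul_pos hw1 h1, mul_pos hw2 h2]

/-- Two affine functions of t that agree at two parameters coincide. This makes overlaps of slices
null and the set of tied directions finite. -/
theorem subsingleton_setOf_linear_eq {x y : ℝ × ℝ} (h : x ≠ y) :
    {t : ℝ | (1 - t) * x.1 + t * x.2 = (1 - t) * y.1 + t * y.2}.Subsingleton := by
  intro s hs t ht
  simp only [Set.mem_ofPred_eq] at hs ht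
  by_contra hst
  apply h
  have h1 : (s - t) * ((x.2 - x.1) - (y.2 - y.1)) = 0 := by linarith
  have h2 := (mul_eq_zero.1 h1).resolve_left (sub_ne_zero.2 hst)
  have h3 : x.1 = y.1 := by
    have : s * (x.2 - x.1 - (y.2 - y.1)) = 0 := by rw [h2, mul_zero]
    linarith
  exact Prod.ext h3 (by linarith)

/-- The values of the normal cones of the envelope add up to one, provided that its elements are
determined by their vectors. -/
theorem sum_coneValue_envelope {L : Type*} [Preorder L] [Finite L] (v : L → ℝ) (p q : L)
    (hne : (metricInterval v p q).Nonempty)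
    (hinj : Set.InjOn (planeVector v p q) (envelope v p q)) :
    ∑ᶠ u ∈ envelope v p q, coneValue (normalCone v p q u) = 1 := by
  classical
  have hfin : (envelope v p q).Finite := Set.toFinite _
  rw [finsum_mem_eq_finite_toFinset_sum _ hfin]
  simp only [coneValue_normalCone]
  have hcl := isClosed_coneSlice_normalCone v p q
  have hsub : ∀ u, coneSlice (normalCone v p q u) ⊆ Set.Icc 0 1 := fun u t ht => ht.1
  have hdisj : Set.Pairwise (↑hfin.toFinset : Set L)
      (Function.onFun (AEDisjoint volume) fun u => coneSlice (normalCone v p q u)) := by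
    intro u hu u' hu' huu'
    rw [Set.Finite.coe_toFinset] at hu hu'
    have hvec : planeVector v p q u ≠ planeVector v p q u' := fun h => huu' (hinj hu hu' h)
    refine measure_mono_null ?_ ((subsingleton_setOf_linear_eq hvec).measure_zero volume)
    rintro t ⟨⟨-, -, -, h1⟩, ⟨-, -, -, h2⟩⟩
    exact le_antisymm (h2 u hu.1) (h1 u' hu'.1)
  -- The exceptional parameters are the two ends and the ties between distinct vectors. Elsewhere
  -- both weights are positive and the maximal vector is unique, which places a maximizer in the
  -- envelope.
  set B : Set ℝ := {0, 1} ∪ ⋃ x : L × L, {t : ℝ | planeVector v p q x.1 ≠ planeVector v p q x.2 ∧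
    (1 - t) * (planeVector v p q x.1).1 + t * (planeVector v p q x.1).2 =
      (1 - t) * (planeVector v p q x.2).1 + t * (planeVector v p q x.2).2} with hB
  have hBfin : B.Finite := by
    refine (Set.toFinite _).union (Set.finite_iUnion fun x => ?_)
    by_cases h : planeVector v p q x.1 = planeVector v p q x.2
    · simp [h]
    · exact (subsingleton_setOf_linear_eq h).finite.subset fun t ht => ht.2
  have hcover : Set.Icc (0 : ℝ) 1 \ B ⊆
      ⋃ u ∈ hfin.toFinset, coneSlice (normalCone v p q u) := by
    rintro t ⟨ht, htB⟩
    simp only [hB, Set.mem_union, Set.mem_iUnion, not_or, not_exists, Set.mem_insert_iff,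
      Set.mem_singleton_iff, Set.mem_ofPred_eq, not_and] at htB
    obtain ⟨⟨ht0, ht1⟩, htB⟩ := htB
    have ht0' : 0 < t := lt_of_le_of_ne ht.1 (Ne.symm ht0)
    have ht1' : 0 < 1 - t := sub_pos.2 (lt_of_le_of_ne ht.2 ht1)
    obtain ⟨u, hu, hmax⟩ := Set.exists_max_image (metricInterval v p q)
      (fun u => (1 - t) * (planeVector v p q u).1 + t * (planeVector v p q u).2)
      (Set.toFinite _) hne
    have hlt : ∀ x ∈ planeVector v p q '' metricInterval v p q, x = planeVector v p q u ∨
        ((1 - t, t) : ℝ × ℝ).1 * x.1 + ((1 - t, t) : ℝ × ℝ).2 * x.2 <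
          ((1 - t, t) : ℝ × ℝ).1 * (planeVector v p q u).1 +
            ((1 - t, t) : ℝ × ℝ).2 * (planeVector v p q u).2 := by
      rintro _ ⟨u', hu', rfl⟩
      by_cases h : planeVector v p q u' = planeVector v p q u
      · exact Or.inl h
      · exact Or.inr (lt_of_le_of_ne (hmax u' hu') (htB (u', u) h))
    simp only [Set.mem_iUnion, Set.Finite.mem_toFinset]
    exact ⟨u, ⟨hu, mem_extremePoints_of_forall_lt ⟨u, hu, rfl⟩ hlt,
      add_notMem_convexHull_of_forall_lt ht1' ht0' hlt⟩, ht, ht1'.le, ht0'.le, hmax⟩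
  have hmeas := measure_biUnion_finset₀ hdisj fun u _ => (hcl u).measurableSet.nullMeasurableSet
  have hone : volume (⋃ u ∈ hfin.toFinset, coneSlice (normalCone v p q u)) = 1 := by
    apply le_antisymm
    · refine (measure_mono (Set.iUnion₂_subset fun u _ => hsub u)).trans ?_
      simp
    · refine le_trans ?_ (measure_mono hcover)
      rw [measure_sdiff_null (hBfin.measure_zero volume)]
      simp
  have hlt : ∀ u ∈ hfin.toFinset, volume (coneSlice (normalCone v p q u)) ≠ ⊤ := fun u _ =>
    ((measure_mono (hsub u)).trans_lt (by simp)).ne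
  rw [hone] at hmeas
  have := congrArg ENNReal.toReal hmeas
  rw [ENNReal.toReal_sum hlt, ENNReal.toReal_one] at this
  exact this.symm

/-! ### Modular semilattices with a valuation -/

/-! ### Weights of walks -/

theorem SimpleGraph.Walk.weight_cons {V : Type*} {G : SimpleGraph V} (len : Sym2 V → ℝ)
    {p q r : V} (h : G.Adj p q) (w : G.Walk q r) :
    (SimpleGraph.Walk.cons h w).weight len = len s(p, q) + w.weight len := by
  simp [SimpleGraph.Walk.weight]

theorem SimpleGraph.Walk.weight_nil {V : Type*} {G : SimpleGraph V} (len : Sym2 V → ℝ) (p : V) :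
    (SimpleGraph.Walk.nil : G.Walk p p).weight len = 0 := by
  simp [SimpleGraph.Walk.weight]

theorem SimpleGraph.Walk.weight_append {V : Type*} {G : SimpleGraph V} (len : Sym2 V → ℝ)
    {p q r : V} (w : G.Walk p q) (w' : G.Walk q r) :
    (w.append w').weight len = w.weight len + w'.weight len := by
  simp [SimpleGraph.Walk.weight, SimpleGraph.Walk.edges_append]

theorem SimpleGraph.Walk.weight_reverse {V : Type*} {G : SimpleGraph V} (len : Sym2 V → ℝ)
    {p q : V} (w : G.Walk p q) : w.reverse.weight len = w.weight len := by
  simp [SimpleGraph.Walk.weight, SimpleGraph.Walk.edges_reverse]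

/-- A lower bound for all walks that is attained by a walk is the weighted distance. -/
theorem SimpleGraph.weightedDist_eq {V : Type*} {G : SimpleGraph V} {len : Sym2 V → ℝ} {p q : V}
    {d : ℝ} (hle : ∀ w : G.Walk p q, d ≤ w.weight len) (hex : ∃ w : G.Walk p q, w.weight len ≤ d) :
    G.weightedDist len p q = d := by
  obtain ⟨w, hw⟩ := hex
  have : Nonempty (G.Walk p q) := ⟨w⟩
  refine le_antisymm ((ciInf_le ⟨d, ?_⟩ w).trans hw) (le_ciInf hle)
  rintro _ ⟨w, rfl⟩
  exact hle w

/-- A strictly monotone modular valuation on a modular semilattice: bounded pairs have joins,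
and pairwise bounded triples are bounded. -/
structure IsModularValuation {L : Type*} [SemilatticeInf L] (v : L → ℝ) : Prop where
  strictMono : StrictMono v
  exists_join : ∀ x y w : L, x ≤ w → y ≤ w → ∃ j, IsLUB {x, y} j ∧ v j + v (x ⊓ y) = v x + v y
  triple : ∀ x y z : L, (∃ w, x ≤ w ∧ y ≤ w) → (∃ w, x ≤ w ∧ z ≤ w) → (∃ w, y ≤ w ∧ z ≤ w) →
    ∃ w, x ≤ w ∧ y ≤ w ∧ z ≤ w

theorem semilatticeMeet_eq_inf {L : Type*} [SemilatticeInf L] (x y : L) :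
    semilatticeMeet x y = x ⊓ y := by
  have h : ∃ m, IsGLB {x, y} m := ⟨_, isGLB_pair⟩
  unfold semilatticeMeet
  rw [dif_pos h]
  exact h.choose_spec.unique isGLB_pair

theorem coneValue_normalCone_nonneg {L : Type*} [Preorder L] (v : L → ℝ) (p q u : L) :
    0 ≤ coneValue (normalCone v p q u) := by
  rw [coneValue_normalCone]
  exact measureReal_nonneg

theorem coneValue_normalCone_le_one {L : Type*} [Preorder L] (v : L → ℝ) (p q u : L) :
    coneValue (normalCone v p q u) ≤ 1 := by
  rw [coneValue_normalCone]
  have h : coneSlice (normalCone v p q u) ⊆ Set.Icc 0 1 := fun t ht => ht.1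
  refine (measureReal_mono h (by simp)).trans ?_
  simp

namespace IsModularValuation

variable {L : Type*} [SemilatticeInf L] {v : L → ℝ} (hv : IsModularValuation v)
include hv

theorem add_le {x y w : L} (hx : x ≤ w) (hy : y ≤ w) : v x + v y ≤ v w + v (x ⊓ y) := by
  obtain ⟨j, hj, e⟩ := hv.exists_join x y w hx hy
  have : j ≤ w := hj.2 (by rintro z (rfl | rfl) <;> assumption)
  linarith [hv.strictMono.monotone this]

/-- Since a and c ⊓ b lie below c, `add_le` bounds the growth of the meet with b by v c - v a. Thus
x ↦ v x + v b - 2 v (x ⊓ b) changes along an edge by at most its length, which bounds all walks from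
below. -/
theorem triangle_of_le {a c : L} (h : a ≤ c) (b : L) :
    |v c + v b - 2 * v (c ⊓ b) - (v a + v b - 2 * v (a ⊓ b))| ≤ v c - v a := by
  have h1 := hv.add_le h (inf_le_left : c ⊓ b ≤ c)
  have h2 : a ⊓ (c ⊓ b) = a ⊓ b := by rw [← inf_assoc, inf_eq_left.2 h]
  rw [h2] at h1
  have h3 := hv.strictMono.monotone (inf_le_inf_right b h)
  rw [abs_le]
  constructor <;> linarith

theorem exists_walk_of_le [Finite L] {a b : L} (h : b ≤ a) :
    ∃ w : (SimpleGraph.hasse L).Walk a b, w.weight (valuationLength v) = v a - v b := by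
  induction a using WellFoundedLT.induction with
  | ind a ih =>
    rcases h.eq_or_lt with rfl | h
    · exact ⟨.nil, by simp [SimpleGraph.Walk.weight_nil]⟩
    · obtain ⟨c, hbc, hca⟩ := exists_le_covBy_of_lt h
      obtain ⟨w, hw⟩ := ih c hca.lt hbc
      refine ⟨.cons (SimpleGraph.hasse_adj.2 (Or.inr hca)) w, ?_⟩
      rw [SimpleGraph.Walk.weight_cons, hw]
      have : valuationLength v s(a, c) = v a - v c := by
        show |v c - v a| = _
        rw [abs_sub_comm, abs_of_nonneg (sub_nonneg.2 (hv.strictMono.monotone hca.le))]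
      linarith

theorem le_weight {a b : L} (w : (SimpleGraph.hasse L).Walk a b) :
    v a + v b - 2 * v (a ⊓ b) ≤ w.weight (valuationLength v) := by
  induction w with
  | nil => simp [SimpleGraph.Walk.weight_nil]; linarith
  | @cons a c b h w ih =>
    rw [SimpleGraph.Walk.weight_cons]
    have : |v c + v b - 2 * v (c ⊓ b) - (v a + v b - 2 * v (a ⊓ b))| ≤
        valuationLength v s(a, c) := by
      show _ ≤ |v c - v a|
      rcases SimpleGraph.hasse_adj.1 h with h | h
      · exact (hv.triangle_of_le h.le b).trans (le_abs_self _)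
      · rw [abs_sub_comm, abs_sub_comm (v c)]
        exact (hv.triangle_of_le h.le b).trans (le_abs_self _)
    have := neg_le_of_abs_le this
    linarith

theorem semilatticeDist_eq [Finite L] (a b : L) :
    semilatticeDist v a b = v a + v b - 2 * v (a ⊓ b) := by
  obtain ⟨w, hw⟩ := hv.exists_walk_of_le (inf_le_left : a ⊓ b ≤ a)
  obtain ⟨w', hw'⟩ := hv.exists_walk_of_le (inf_le_right : a ⊓ b ≤ b)
  refine SimpleGraph.weightedDist_eq hv.le_weight ⟨w.append w'.reverse, ?_⟩
  rw [SimpleGraph.Walk.weight_append, SimpleGraph.Walk.weight_reverse, hw, hw']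
  linarith

/-! ### Metric intervals of a modular valuation -/

theorem mem_metricInterval_iff [Finite L] {p q u : L} :
    u ∈ metricInterval v p q ↔ v u + v (p ⊓ q) = v (p ⊓ u) + v (u ⊓ q) := by
  unfold metricInterval
  simp only [hv.semilatticeDist_eq, Set.mem_ofPred_eq]
  constructor <;> intro h <;> linarith

theorem add_le_of_le {a b p q u : L} (ha : a ≤ u) (hap : a ≤ p) (hb : b ≤ u) (hbq : b ≤ q) :
    v a + v b ≤ v u + v (p ⊓ q) := by
  have h1 := hv.add_le ha hb
  have h2 := hv.strictMono.monotone (inf_le_inf hap hbq)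
  linarith

/-- Membership forces v (p ⊓ q) ≤ v (p ⊓ u ⊓ q), and strict monotonicity turns this into equality of
the two meets. -/
theorem inf_le_of_mem_metricInterval [Finite L] {p q u : L} (h : u ∈ metricInterval v p q) :
    p ⊓ q ≤ u := by
  rw [hv.mem_metricInterval_iff] at h
  have h1 := hv.add_le (inf_le_right : p ⊓ u ≤ u) (inf_le_left : u ⊓ q ≤ u)
  have h2 : v (p ⊓ q) ≤ v (p ⊓ u ⊓ (u ⊓ q)) := by linarith
  have h3 : p ⊓ u ⊓ (u ⊓ q) ≤ p ⊓ q := inf_le_inf inf_le_left inf_le_right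
  rcases h3.eq_or_lt with h4 | h4
  · rw [← h4]
    exact inf_le_left.trans inf_le_right
  · exact absurd (hv.strictMono h4) (not_lt.2 h2)

/-- An element of the interval is the join of its meets with p and q: both lie below u ⊓ w, whose
value therefore cannot be smaller than v u. -/
theorem le_of_mem_metricInterval [Finite L] {p q u w : L} (h : u ∈ metricInterval v p q)
    (h1 : p ⊓ u ≤ w) (h2 : u ⊓ q ≤ w) : u ≤ w := by
  have h0 := hv.mem_metricInterval_iff.1 h
  have h3 := hv.add_le (le_inf inf_le_right h1 : p ⊓ u ≤ u ⊓ w) (le_inf inf_le_left h2)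
  have h4 : v (p ⊓ u ⊓ (u ⊓ q)) ≤ v (p ⊓ q) :=
    hv.strictMono.monotone (inf_le_inf inf_le_left inf_le_right)
  rcases (inf_le_left : u ⊓ w ≤ u).eq_or_lt with h5 | h5
  · exact inf_eq_left.1 h5
  · linarith [hv.strictMono h5]

/-- The join of an element below `p` and an element below `q` lies in the interval. -/
theorem join_mem_metricInterval [Finite L] {p q a b s : L} (ha : a ≤ p) (hb : b ≤ q)
    (hpa : p ⊓ q ≤ a) (hpb : p ⊓ q ≤ b) (hs : IsLUB {a, b} s) :
    s ∈ metricInterval v p q ∧ p ⊓ s = a ∧ s ⊓ q = b := by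
  have has : a ≤ s := hs.1 (by simp)
  have hbs : b ≤ s := hs.1 (by simp)
  obtain ⟨s', hs', e⟩ := hv.exists_join a b s has hbs
  obtain rfl := hs'.unique hs
  have hab : a ⊓ b = p ⊓ q := le_antisymm (inf_le_inf ha hb) (le_inf hpa hpb)
  rw [hab] at e
  -- This bounds v (p ⊓ s) + v (s ⊓ q) above by v a + v b, while a ≤ p ⊓ s and b ≤ s ⊓ q. Hence both
  -- inequalities are equalities.
  have h1 := hv.add_le_of_le (inf_le_right : p ⊓ s' ≤ s') inf_le_left
    (inf_le_left : s' ⊓ q ≤ s') inf_le_right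
  have h2 : a ≤ p ⊓ s' := le_inf ha has
  have h3 : b ≤ s' ⊓ q := le_inf hbs hb
  have h4 := hv.strictMono.monotone h2
  have h5 := hv.strictMono.monotone h3
  refine ⟨hv.mem_metricInterval_iff.2 (by linarith), ?_, ?_⟩
  · rcases h2.eq_or_lt with h | h
    · exact h.symm
    · linarith [hv.strictMono h]
  · rcases h3.eq_or_lt with h | h
    · exact h.symm
    · linarith [hv.strictMono h]

theorem left_mem_metricInterval [Finite L] (p q : L) : p ∈ metricInterval v p q := by
  rw [hv.mem_metricInterval_iff, inf_idem]

theorem inf_mem_metricInterval [Finite L] (p q : L) : p ⊓ q ∈ metricInterval v p q := by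
  rw [hv.mem_metricInterval_iff, inf_left_idem, inf_assoc, inf_idem]

/-- An element of the envelope is determined by its vector. -/
theorem injOn_planeVector [Finite L] (p q : L) :
    Set.InjOn (planeVector v p q) (envelope v p q) := by
  have hz : ∀ u : L, planeVector v p q u = (v (p ⊓ u) - v (p ⊓ q), v (u ⊓ q) - v (p ⊓ q)) := by
    intro u
    simp only [planeVector, semilatticeMeet_eq_inf, inf_comm u p]
  rintro u ⟨hu, hext, -⟩ u' ⟨hu', -⟩ he
  have hpu := hv.inf_le_of_mem_metricInterval hu
  have hpu' := hv.inf_le_of_mem_metricInterval hu'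
  have he1 : v (p ⊓ u) = v (p ⊓ u') := by
    have := congrArg Prod.fst he
    simp only [hz] at this
    linarith
  have he2 : v (u ⊓ q) = v (u' ⊓ q) := by
    have := congrArg Prod.snd he
    simp only [hz] at this
    linarith
  obtain ⟨A, hA, eA⟩ := hv.exists_join (p ⊓ u) (p ⊓ u') p inf_le_left inf_le_left
  obtain ⟨B, hB, eB⟩ := hv.exists_join (u ⊓ q) (u' ⊓ q) q inf_le_right inf_le_right
  have hA1 : p ⊓ u ≤ A := hA.1 (by simp)
  have hA2 : p ⊓ u' ≤ A := hA.1 (by simp)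
  have hB1 : u ⊓ q ≤ B := hB.1 (by simp)
  have hB2 : u' ⊓ q ≤ B := hB.1 (by simp)
  have hAp : A ≤ p := hA.2 (by rintro z (rfl | rfl) <;> exact inf_le_left)
  have hBq : B ≤ q := hB.2 (by rintro z (rfl | rfl) <;> exact inf_le_right)
  have pq1 : p ⊓ q ≤ p ⊓ u := le_inf inf_le_left hpu
  have pq1' : p ⊓ q ≤ p ⊓ u' := le_inf inf_le_left hpu'
  have pq2 : p ⊓ q ≤ u ⊓ q := le_inf hpu inf_le_right
  have pq2' : p ⊓ q ≤ u' ⊓ q := le_inf hpu' inf_le_right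
  -- The triple is pairwise bounded by p, u and u'. So the join of the two meets with p is
  -- compatible with the common part of the meets with q; the next triple is the mirror image.
  obtain ⟨w, hw1, hw2, hw3⟩ := hv.triple (p ⊓ u) (p ⊓ u') (u ⊓ q ⊓ (u' ⊓ q))
    ⟨p, inf_le_left, inf_le_left⟩ ⟨u, inf_le_right, inf_le_left.trans inf_le_left⟩
    ⟨u', inf_le_right, inf_le_right.trans inf_le_left⟩
  obtain ⟨w', hw1', hw2', hw3'⟩ := hv.triple (p ⊓ u ⊓ (p ⊓ u')) (u ⊓ q) (u' ⊓ q)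
    ⟨u, inf_le_left.trans inf_le_right, inf_le_left⟩
    ⟨u', inf_le_right.trans inf_le_right, inf_le_left⟩
    ⟨q, inf_le_right, inf_le_right⟩
  obtain ⟨s, hs, -⟩ := hv.exists_join A (u ⊓ q ⊓ (u' ⊓ q)) w
    (hA.2 (by rintro z (rfl | rfl) <;> assumption)) hw3
  obtain ⟨s', hs', -⟩ := hv.exists_join (p ⊓ u ⊓ (p ⊓ u')) B w' hw1'
    (hB.2 (by rintro z (rfl | rfl) <;> assumption))
  obtain ⟨hsI, hs1, hs2⟩ := hv.join_mem_metricInterval hAp (inf_le_left.trans inf_le_right)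
    (pq1.trans hA1) (le_inf pq2 pq2') hs
  obtain ⟨hsI', hs1', hs2'⟩ := hv.join_mem_metricInterval (inf_le_left.trans inf_le_left) hBq
    (le_inf pq1 pq1') (pq2.trans hB1) hs'
  rw [mem_extremePoints] at hext
  -- By modularity in each coordinate, the vector of u is the midpoint of those of s and s'.
  -- Extremality makes all three equal, so A and B add nothing to the meets of u or u'.
  have hmid := hext.2 (planeVector v p q s)
    (subset_convexHull ℝ _ ⟨s, hsI, rfl⟩) (planeVector v p q s')
    (subset_convexHull ℝ _ ⟨s', hsI', rfl⟩)
    ⟨1 / 2, 1 / 2, by norm_num, by norm_num, by norm_num, by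
      rw [hz, hz, hz, hs1, hs2, hs1', hs2']
      ext <;> simp <;> linarith⟩
  have h1 : v A = v (p ⊓ u) := by
    have := congrArg Prod.fst hmid.1
    rw [hz, hz, hs1] at this
    simpa using this
  have h2 : v B = v (u ⊓ q) := by
    have := congrArg Prod.snd hmid.2
    rw [hz, hz, hs2'] at this
    simpa using this
  have eq_of : ∀ {a b : L}, a ≤ b → v b = v a → a = b := fun hab h => by
    rcases hab.eq_or_lt with h' | h'
    · exact h'
    · linarith [hv.strictMono h']
  have k1 : p ⊓ u = p ⊓ u' := (eq_of hA1 h1).trans (eq_of hA2 (h1.trans he1)).symm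
  have k2 : u ⊓ q = u' ⊓ q := (eq_of hB1 h2).trans (eq_of hB2 (h2.trans he2)).symm
  exact le_antisymm
    (hv.le_of_mem_metricInterval hu (k1.trans_le inf_le_right) (k2.trans_le inf_le_left))
    (hv.le_of_mem_metricInterval hu' (k1.symm.trans_le inf_le_right)
      (k2.symm.trans_le inf_le_left))

theorem sum_coneValue [Finite L] (p q : L) :
    ∑ᶠ u ∈ envelope v p q, coneValue (normalCone v p q u) = 1 :=
  sum_coneValue_envelope v p q ⟨p, hv.left_mem_metricInterval p q⟩ (hv.injOn_planeVector p q)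

/-- Near the direction (1,0) the element p beats q, because p ≰ q makes the first coordinate of p
positive while that of q is zero. The slice of q misses an interval of positive length. -/
theorem coneValue_right_lt_one [Finite L] {p q : L} (hpq : ¬ p ≤ q) :
    coneValue (normalCone v p q q) < 1 := by
  rw [coneValue_normalCone]
  have hlt : v (p ⊓ q) < v p := hv.strictMono (inf_lt_left.2 hpq)
  have hpz : (planeVector v p q p).1 = v p - v (p ⊓ q) := by
    simp [planeVector, semilatticeMeet_eq_inf]
  have hqz : (planeVector v p q q).1 = 0 := by
    simp [planeVector, semilatticeMeet_eq_inf, inf_comm]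
  set a := v p - v (p ⊓ q) with ha
  have ha0 : 0 < a := sub_pos.2 hlt
  set d := (planeVector v p q q).2 - (planeVector v p q p).2 with hd
  -- Comparison of q with p in direction (1 - t, t) reads a ≤ t (a + d), and d is replaced by |d| to
  -- keep the denominator positive.
  have hsub : coneSlice (normalCone v p q q) ⊆ Set.Icc (a / (a + |d|)) 1 := by
    rintro t ⟨⟨ht0, ht1⟩, -, -, h⟩
    refine ⟨?_, ht1⟩
    have h' := h p (hv.left_mem_metricInterval p q)
    simp only [hpz, hqz] at h'
    have h2 : t * d ≤ t * |d| := mul_le_mul_of_nonneg_left (le_abs_self d) ht0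
    rw [div_le_iff₀ (by positivity)]
    have h3 : t * d = t * (planeVector v p q q).2 - t * (planeVector v p q p).2 := by
      rw [hd]; ring
    linarith
  have hpos : 0 < a / (a + |d|) := by positivity
  have hle : a / (a + |d|) ≤ 1 := by
    rw [div_le_one (by positivity)]
    linarith [abs_nonneg d]
  have := measureReal_mono hsub (μ := volume) (by simp)
  rw [Real.volume_real_Icc_of_le hle] at this
  linarith

/-- A submodular function takes a small value strictly between incomparable elements. -/
theorem exists_mem_metricInterval_lt [Finite L] {f : L → ℝ} (hf : IsSubmodular v f) {x y : L}
    {α : ℝ} (hx : f x ≤ α) (hy : f y < α) (hxy : ¬ x ≤ y) (hyx : ¬ y ≤ x) :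
    ∃ z ∈ metricInterval v x y, z ≠ x ∧ z ≠ y ∧ f z < α := by
  classical
  by_contra! hcon
  have hsub := hf x y
  have hsum := hv.sum_coneValue x y
  have hfin : (envelope v x y).Finite := Set.toFinite _
  rw [finsum_mem_eq_finite_toFinset_sum _ hfin] at hsub hsum
  rw [semilatticeMeet_eq_inf] at hsub
  have hinf : α ≤ f (x ⊓ y) := hcon _ (hv.inf_mem_metricInterval x y)
    (fun h => hxy (inf_eq_left.1 h)) (fun h => hyx (inf_eq_right.1 h))
  have hne : x ≠ y := fun h => hxy h.le
  set c : L → ℝ := fun u => coneValue (normalCone v x y u) with hc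
  have hc0 : ∀ u, 0 ≤ c u := fun u => coneValue_normalCone_nonneg v x y u
  have hcy : c y < 1 := hv.coneValue_right_lt_one hxy
  have hcx : c x ≤ 1 := coneValue_normalCone_le_one v x y x
  -- Only x and y can contribute negatively to the average of f - α. If one of them is not in the
  -- envelope, its nonpositive term is merely missing, which is why lower bounds suffice below.
  have hterm : ∀ u ∈ hfin.toFinset, (if u = x then c x * (f x - α) else 0) +
      (if u = y then c y * (f y - α) else 0) ≤ c u * (f u - α) := by
    intro u hu
    have hu' : u ∈ metricInterval v x y := ((Set.Finite.mem_toFinset _).1 hu).1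
    by_cases hux : u = x
    · subst hux
      simp [hne]
    · by_cases huy : u = y
      · subst huy
        simp [hux]
      · simp only [hux, huy, if_false, add_zero]
        exact mul_nonneg (hc0 u) (sub_nonneg.2 (hcon u hu' hux huy))
  have hS := Finset.sum_le_sum hterm
  rw [Finset.sum_add_distrib, Finset.sum_ite_eq', Finset.sum_ite_eq'] at hS
  simp only [mul_sub, Finset.sum_sub_distrib, ← Finset.sum_mul] at hS
  rw [hsum] at hS
  have hSx : c x * (f x - α) ≤ (if x ∈ hfin.toFinset then c x * f x - c x * α else 0) := by
    split_ifs
    · linarith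
    · exact mul_nonpos_of_nonneg_of_nonpos (hc0 x) (by linarith)
  have hSy : c y * (f y - α) ≤ (if y ∈ hfin.toFinset then c y * f y - c y * α else 0) := by
    split_ifs
    · linarith
    · exact mul_nonpos_of_nonneg_of_nonpos (hc0 y) (by linarith)
  -- The submodular inequality would make the sum of these two quantities nonnegative.
  have h1 : (1 - c x) * (f x - α) ≤ 0 :=
    mul_nonpos_of_nonneg_of_nonpos (by linarith) (by linarith)
  have h2 : (1 - c y) * (f y - α) < 0 := mul_neg_of_pos_of_neg (by linarith) (by linarith)
  linarith

theorem dist_pos [Finite L] {x y : L} (h : x ≠ y) : 0 < semilatticeDist v x y := by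
  rw [hv.semilatticeDist_eq]
  have h1 := hv.strictMono.monotone (inf_le_left : x ⊓ y ≤ x)
  have h2 := hv.strictMono.monotone (inf_le_right : x ⊓ y ≤ y)
  rcases (inf_le_left : x ⊓ y ≤ x).eq_or_lt with h3 | h3
  · rcases (inf_le_right : x ⊓ y ≤ y).eq_or_lt with h4 | h4
    · exact absurd (h3.symm.trans h4) h
    · linarith [hv.strictMono h4]
  · linarith [hv.strictMono h3]

/-- Two elements with small values are joined by a path of comparable elements with small
values. -/
theorem reflTransGen_comparable [Finite L] {f : L → ℝ} (hf : IsSubmodular v f) {α : ℝ} (x y : L)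
    (hx : f x ≤ α) (hy : f y < α) :
    Relation.ReflTransGen (fun a b => (a ≤ b ∨ b ≤ a) ∧ f b < α) x y := by
  -- Distances are real, but there are only finitely many pairs to compare.
  have wf : WellFounded fun a b : L × L =>
      semilatticeDist v a.1 a.2 < semilatticeDist v b.1 b.2 :=
    have : IsTrans (L × L) fun a b => semilatticeDist v a.1 a.2 < semilatticeDist v b.1 b.2 :=
      ⟨fun _ _ _ h h' => lt_trans h h'⟩
    have : Std.Irrefl fun a b : L × L => semilatticeDist v a.1 a.2 < semilatticeDist v b.1 b.2 :=
      ⟨fun _ h => lt_irrefl _ h⟩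
    Finite.wellFounded_of_trans_of_irrefl _
  suffices h : ∀ a : L × L, f a.1 ≤ α → f a.2 < α →
      Relation.ReflTransGen (fun a b => (a ≤ b ∨ b ≤ a) ∧ f b < α) a.1 a.2 from h (x, y) hx hy
  intro a
  induction a using wf.induction with
  | _ a ih =>
    obtain ⟨x, y⟩ := a
    intro hx hy
    by_cases hxy : x ≤ y ∨ y ≤ x
    · exact Relation.ReflTransGen.single ⟨hxy, hy⟩
    · rw [not_or] at hxy
      obtain ⟨z, hz, hzx, hzy, hfz⟩ := hv.exists_mem_metricInterval_lt hf hx hy hxy.1 hxy.2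
      have hd : semilatticeDist v x z + semilatticeDist v z y = semilatticeDist v x y := hz
      have h1 := hv.dist_pos hzx.symm
      have h2 := hv.dist_pos hzy
      exact (ih (x, z) (by simp only; linarith) hx hfz).trans
        (ih (z, y) (by simp only; linarith) hfz.le hy)

end IsModularValuation

/-! ### Admissible orientations of modular graphs -/

namespace OrientedLengthGraph

variable {V : Type*} {Γ : OrientedLengthGraph V}

/-- The complex with the reversed orientation. -/
def reverse (Γ : OrientedLengthGraph V) : OrientedLengthGraph V where
  graph := Γ.graph
  below p q := Γ.below q p
  adj_iff p q := by rw [Γ.adj_iff, or_comm]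
  asymm p q h h' := Γ.asymm _ _ h h'
  len := Γ.len

theorem precedes_reverse {p q : V} : Γ.reverse.Precedes p q ↔ Γ.Precedes q p :=
  Relation.reflTransGen_swap

theorem adj_of_below {p q : V} (h : Γ.below p q) : Γ.graph.Adj p q :=
  (Γ.adj_iff p q).2 (Or.inl h)

theorem dist_eq_one_of_below {p q : V} (h : Γ.below p q) : Γ.graph.dist p q = 1 :=
  SimpleGraph.dist_eq_one_iff_adj.2 (adj_of_below h)

theorem not_below_iff {p q : V} (h : Γ.graph.Adj p q) : ¬ Γ.below p q ↔ Γ.below q p :=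
  ⟨((Γ.adj_iff p q).1 h).resolve_left, fun h' h'' => Γ.asymm _ _ h' h''⟩

theorem Precedes.of_below {p q : V} (h : Γ.below p q) : Γ.Precedes p q :=
  Relation.ReflTransGen.single h

theorem Precedes.refl (p : V) : Γ.Precedes p p := Relation.ReflTransGen.refl

theorem Precedes.trans {p q r : V} (h : Γ.Precedes p q) (h' : Γ.Precedes q r) : Γ.Precedes p r :=
  Relation.ReflTransGen.trans h h'

theorem exists_below_of_ne {p q : V} (h : Γ.Precedes p q) (hne : p ≠ q) :
    ∃ x, Γ.below p x ∧ Γ.Precedes x q := by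
  rcases Relation.ReflTransGen.cases_head h with h | ⟨x, h1, h2⟩
  · exact absurd h hne
  · exact ⟨x, h1, h2⟩

/-- There is an ascending path with `k` edges. -/
def AscendsIn (Γ : OrientedLengthGraph V) : ℕ → V → V → Prop
  | 0, p, q => p = q
  | k + 1, p, q => ∃ s, Γ.AscendsIn k p s ∧ Γ.below s q

theorem AscendsIn.precedes {k : ℕ} {p q : V} (h : Γ.AscendsIn k p q) : Γ.Precedes p q := by
  induction k generalizing q with
  | zero =>
    obtain rfl : p = q := h
    exact Precedes.refl p
  | succ k ih =>
    obtain ⟨s, hs, hsq⟩ := h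
    exact (ih hs).tail hsq

theorem Precedes.exists_ascendsIn {p q : V} (h : Γ.Precedes p q) : ∃ k, Γ.AscendsIn k p q := by
  induction h with
  | refl => exact ⟨0, rfl⟩
  | tail _ h ih =>
    obtain ⟨k, hk⟩ := ih
    exact ⟨k + 1, _, hk, h⟩

/-- `j` is the least upper bound of `a` and `b`. -/
structure IsJoin (Γ : OrientedLengthGraph V) (a b j : V) : Prop where
  left : Γ.Precedes a j
  right : Γ.Precedes b j
  least : ∀ u, Γ.Precedes a u → Γ.Precedes b u → Γ.Precedes j u

/-- `m` is the greatest lower bound of `a` and `b` above `r`. -/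
structure IsMeet (Γ : OrientedLengthGraph V) (r a b m : V) : Prop where
  base : Γ.Precedes r m
  left : Γ.Precedes m a
  right : Γ.Precedes m b
  greatest : ∀ c, Γ.Precedes r c → Γ.Precedes c a → Γ.Precedes c b → Γ.Precedes c m

namespace IsModularComplex

variable (hΓ : Γ.IsModularComplex)
include hΓ

theorem reverse : Γ.reverse.IsModularComplex where
  modular := hΓ.modular
  admissible u v v' u' h := by
    have h1 := hΓ.admissible u v v' u' h
    have h2 : Γ.graph.Adj u v := h.1
    have h3 : Γ.graph.Adj u' v' := h.2.2.1.symm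
    show Γ.below v u ↔ Γ.below v' u'
    rw [← not_below_iff h2, ← not_below_iff h3, h1]
  pos := hΓ.pos
  orbitInvariant := hΓ.orbitInvariant

/-! ### Distances and ascending paths in modular graphs -/

theorem connected : Γ.graph.Connected := hΓ.modular.1

/-- A median of p and the two ends of an edge must be one of the ends. -/
theorem dist_adj (p : V) {q q' : V} (h : Γ.graph.Adj q q') :
    Γ.graph.dist p q' = Γ.graph.dist p q + 1 ∨ Γ.graph.dist p q = Γ.graph.dist p q' + 1 := by
  obtain ⟨m, h1, h2, h3⟩ := hΓ.modular.2 p q q'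
  rw [SimpleGraph.dist_eq_one_iff_adj.2 h] at h2
  rw [Γ.graph.dist_comm (u := q') (v := m), Γ.graph.dist_comm (u := m) (v := p),
    Γ.graph.dist_comm (u := q')] at h3
  rw [Γ.graph.dist_comm (u := q)] at h2
  omega

theorem exists_adj_dist {p q : V} (h : p ≠ q) :
    ∃ y, Γ.graph.Adj y q ∧ Γ.graph.dist p y + 1 = Γ.graph.dist p q := by
  obtain ⟨w, hw⟩ := (hΓ.connected q p).exists_walk_length_eq_dist
  cases w with
  | nil => exact absurd rfl h
  | @cons _ y _ hy w =>
    refine ⟨y, hy.symm, ?_⟩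
    have h1 := SimpleGraph.dist_le w
    have h2 := hΓ.dist_adj p hy
    rw [SimpleGraph.Walk.length_cons, Γ.graph.dist_comm] at hw
    rw [Γ.graph.dist_comm] at h1
    omega

theorem eq_of_dist_eq_zero {p q : V} (h : Γ.graph.dist p q = 0) : p = q :=
  (hΓ.connected.dist_eq_zero_iff).1 h

/-- The fourth vertex is a median of p, q, q': as q and q' are equally far from p, it is equally far
from both, so their distance is even and equals 2. -/
theorem quadrangle {p s q q' : V} (h : Γ.graph.Adj q s) (h' : Γ.graph.Adj q' s) (hne : q ≠ q')
    (hd : Γ.graph.dist p q + 1 = Γ.graph.dist p s)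
    (hd' : Γ.graph.dist p q' + 1 = Γ.graph.dist p s) :
    ∃ t, Γ.graph.IsFourCycle t q s q' ∧ Γ.graph.dist p t + 2 = Γ.graph.dist p s := by
  obtain ⟨m, h1, h2, h3⟩ := hΓ.modular.2 p q q'
  have h4 : Γ.graph.dist q q' ≤ 2 := SimpleGraph.dist_le (.cons h (.cons h'.symm .nil))
  have h5 : Γ.graph.dist q q' ≠ 0 := fun h => hne (hΓ.eq_of_dist_eq_zero h)
  rw [Γ.graph.dist_comm (u := q') (v := m), Γ.graph.dist_comm (u := m) (v := p),
    Γ.graph.dist_comm (u := q')] at h3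
  have h6 : Γ.graph.dist m q = Γ.graph.dist m q' := by omega
  rw [Γ.graph.dist_comm (u := q) (v := m)] at h2
  have h7 : Γ.graph.dist m q = 1 := by omega
  have h8 : Γ.graph.dist m q' = 1 := by omega
  refine ⟨m, ⟨SimpleGraph.dist_eq_one_iff_adj.1 h7, h, h'.symm,
    (SimpleGraph.dist_eq_one_iff_adj.1 h8).symm, ?_, hne⟩, by omega⟩
  rintro rfl
  omega

/-- Two claims are proved in one induction: an ascending path is a geodesic, and every neighbour of
its end nearer to p is below the end and is itself reached by ascending. Two nearer neighbours lie
on a 4-cycle by `quadrangle`, and admissibility transports the orientations across it. -/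
theorem ascendsIn_spec {p : V} (k : ℕ) : ∀ q, Γ.AscendsIn k p q → Γ.graph.dist p q = k ∧
    ∀ x, Γ.graph.Adj x q → Γ.graph.dist p x + 1 = Γ.graph.dist p q →
      Γ.below x q ∧ ∀ j, j + 1 = k → Γ.AscendsIn j p x := by
  induction k with
  | zero =>
    rintro q rfl
    simp
  | succ k ih =>
    rintro q ⟨s, hs, hsq⟩
    obtain ⟨h1, h2⟩ := ih s hs
    have hq : Γ.graph.dist p q = k + 1 := by
      rcases hΓ.dist_adj p (adj_of_below hsq) with h | h
      · omega
      -- If the distance dropped, q would be a nearer neighbour of s and hence below s.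
      · exact absurd (h2 q (adj_of_below hsq).symm (by omega)).1 (Γ.asymm _ _ hsq)
    refine ⟨hq, fun x hx hd => ?_⟩
    by_cases hxs : x = s
    · subst hxs
      exact ⟨hsq, fun j hj => by obtain rfl : j = k := by omega
                                 exact hs⟩
    · obtain ⟨t, ht, htd⟩ := hΓ.quadrangle (p := p) (adj_of_below hsq) hx (Ne.symm hxs)
        (by omega) hd
      obtain ⟨h3, h4⟩ := h2 t ht.1 (by omega)
      have hxq := (hΓ.admissible _ _ _ _ ht).1 h3
      have htx := (hΓ.admissible t x q s
        ⟨ht.2.2.2.1.symm, hx, (adj_of_below hsq).symm, ht.1.symm, ht.2.2.2.2.1, hxs⟩).2 hsq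
      refine ⟨hxq, fun j hj => ?_⟩
      obtain ⟨i, rfl⟩ : ∃ i, k = i + 1 := ⟨k - 1, by omega⟩
      obtain rfl : j = i + 1 := by omega
      exact ⟨t, h4 i rfl, htx⟩

theorem below_of_dist {p q x : V} (h : Γ.Precedes p q) (hx : Γ.graph.Adj x q)
    (hd : Γ.graph.dist p x + 1 = Γ.graph.dist p q) : Γ.below x q ∧ Γ.Precedes p x := by
  obtain ⟨k, hk⟩ := h.exists_ascendsIn
  obtain ⟨h1, h2⟩ := hΓ.ascendsIn_spec k q hk
  obtain ⟨h3, h4⟩ := h2 x hx hd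
  exact ⟨h3, (h4 (k - 1) (by omega)).precedes⟩

theorem dist_below {p q q' : V} (h : Γ.Precedes p q) (h' : Γ.below q q') :
    Γ.graph.dist p q' = Γ.graph.dist p q + 1 := by
  obtain ⟨k, hk⟩ := h.exists_ascendsIn
  rw [(hΓ.ascendsIn_spec k q hk).1, (hΓ.ascendsIn_spec (k + 1) q' ⟨q, hk, h'⟩).1]

theorem dist_add {p x q : V} (h : Γ.Precedes p x) (h' : Γ.Precedes x q) :
    Γ.graph.dist p x + Γ.graph.dist x q = Γ.graph.dist p q := by
  induction h' with
  | refl => simp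
  | tail h1 h2 ih =>
    rw [hΓ.dist_below h1 h2, hΓ.dist_below (h.trans h1) h2, ← ih, add_assoc]

theorem antisymm {p q : V} (h : Γ.Precedes p q) (h' : Γ.Precedes q p) : p = q := by
  have := hΓ.dist_add h h'
  rw [SimpleGraph.dist_self] at this
  exact hΓ.eq_of_dist_eq_zero (by omega)

/-- Walking from q towards x also approaches p, so each such step descends by `below_of_dist`. -/
theorem precedes_of_dist_add {p x q : V} (h : Γ.Precedes p q)
    (hd : Γ.graph.dist p x + Γ.graph.dist x q = Γ.graph.dist p q) :
    Γ.Precedes p x ∧ Γ.Precedes x q := by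
  induction hn : Γ.graph.dist x q generalizing q with
  | zero =>
    obtain rfl := hΓ.eq_of_dist_eq_zero hn
    exact ⟨h, Precedes.refl _⟩
  | succ n ih =>
    have hne : x ≠ q := by
      rintro rfl
      simp at hn
    obtain ⟨y, hy, hyd⟩ := hΓ.exists_adj_dist hne
    have h1 := hΓ.connected.dist_triangle (u := p) (v := x) (w := y)
    have h2 := hΓ.dist_adj p hy
    obtain ⟨h3, h4⟩ := hΓ.below_of_dist h hy (by omega)
    obtain ⟨h5, h6⟩ := ih h4 (by omega) (by omega)
    exact ⟨h5, h6.tail h3⟩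

theorem below_of_precedes {p q : V} (h : Γ.Precedes p q) (hd : Γ.graph.dist p q = 1) :
    Γ.below p q :=
  (hΓ.below_of_dist h (SimpleGraph.dist_eq_one_iff_adj.1 hd) (by simp [hd])).1

/-- Two elements covering a common element and bounded above have a join covering both. -/
theorem exists_isJoin_of_below {z x y u : V} (hx : Γ.below z x) (hy : Γ.below z y) (hne : x ≠ y)
    (hxu : Γ.Precedes x u) (hyu : Γ.Precedes y u) :
    ∃ j, Γ.IsJoin x y j ∧ Γ.below x j ∧ Γ.below y j := by
  have key : ∀ u, Γ.Precedes x u → Γ.Precedes y u →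
      ∃ j, Γ.below x j ∧ Γ.below y j ∧ Γ.Precedes j u := by
    intro u hxu hyu
    have h1 := hΓ.dist_add (Precedes.of_below hx) hxu
    have h2 := hΓ.dist_add (Precedes.of_below hy) hyu
    rw [dist_eq_one_of_below hx] at h1
    rw [dist_eq_one_of_below hy] at h2
    obtain ⟨t, ht, htd⟩ := hΓ.quadrangle (p := u) (adj_of_below hx).symm (adj_of_below hy).symm hne
      (by rw [Γ.graph.dist_comm (u := u), Γ.graph.dist_comm (u := u)]; omega)
      (by rw [Γ.graph.dist_comm (u := u), Γ.graph.dist_comm (u := u)]; omega)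
    rw [Γ.graph.dist_comm (u := u), Γ.graph.dist_comm (u := u)] at htd
    have h3 : Γ.graph.dist x t = 1 := SimpleGraph.dist_eq_one_iff_adj.2 ht.1.symm
    have h4 : Γ.graph.dist y t = 1 := SimpleGraph.dist_eq_one_iff_adj.2 ht.2.2.2.1
    obtain ⟨h5, h6⟩ := hΓ.precedes_of_dist_add (x := t) hxu (by omega)
    obtain ⟨h7, -⟩ := hΓ.precedes_of_dist_add (x := t) hyu (by omega)
    exact ⟨t, hΓ.below_of_precedes h5 h3, hΓ.below_of_precedes h7 h4, h6⟩
  obtain ⟨j, hxj, hyj, hju⟩ := key u hxu hyu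
  refine ⟨j, ⟨.of_below hxj, .of_below hyj, fun u' h1 h2 => ?_⟩, hxj, hyj⟩
  obtain ⟨j', hxj', hyj', hju'⟩ := key u' h1 h2
  by_cases hjj : j = j'
  · rwa [hjj]
  · have := (hΓ.admissible x j y j' ⟨adj_of_below hxj, (adj_of_below hyj).symm, adj_of_below hyj',
      (adj_of_below hxj').symm, hne, hjj⟩).1 hxj
    exact absurd hyj' (Γ.asymm _ _ this)

/-- The first steps x' and y' have a join j by the local case. Joining x with j, y with j, and then
the two results uses pairs whose lower bounds x', y', j are closer to u. -/
theorem exists_isJoin {z x y u : V} (hzx : Γ.Precedes z x) (hzy : Γ.Precedes z y)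
    (hxu : Γ.Precedes x u) (hyu : Γ.Precedes y u) : ∃ j, Γ.IsJoin x y j := by
  induction hn : Γ.graph.dist z u using Nat.strong_induction_on generalizing z x y with
  | _ n ih =>
    subst hn
    by_cases hxz : z = x
    · subst hxz
      exact ⟨y, hzy, Precedes.refl y, fun u _ h => h⟩
    by_cases hyz : z = y
    · subst hyz
      exact ⟨x, Precedes.refl x, hzx, fun u h _ => h⟩
    obtain ⟨x', hx', hxx'⟩ := exists_below_of_ne hzx hxz
    obtain ⟨y', hy', hyy'⟩ := exists_below_of_ne hzy hyz
    have lt_of : ∀ {c}, Γ.below z c → Γ.Precedes c u → Γ.graph.dist c u < Γ.graph.dist z u := by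
      intro c hc hcu
      have := hΓ.dist_add (Precedes.of_below hc) hcu
      rw [dist_eq_one_of_below hc] at this
      omega
    have hx'u := hxx'.trans hxu
    have hy'u := hyy'.trans hyu
    by_cases hne : x' = y'
    · subst hne
      exact ih _ (lt_of hx' hx'u) hxx' hyy' hxu hyu rfl
    · obtain ⟨j, hj, hxj, hyj⟩ := hΓ.exists_isJoin_of_below hx' hy' hne hx'u hy'u
      have hju := hj.least u hx'u hy'u
      obtain ⟨s, hs⟩ := ih _ (lt_of hx' hx'u) hxx' hj.left hxu hju rfl
      obtain ⟨t, ht⟩ := ih _ (lt_of hy' hy'u) hyy' hj.right hyu hju rfl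
      have hjlt : Γ.graph.dist j u < Γ.graph.dist z u := by
        have := hΓ.dist_add hj.left hju
        have := lt_of hx' hx'u
        omega
      obtain ⟨w, hw⟩ := ih _ hjlt hs.right ht.right (hs.least u hxu hju) (ht.least u hyu hju) rfl
      refine ⟨w, hs.left.trans hw.left, ht.left.trans hw.right, fun u' h1 h2 => ?_⟩
      have hju' := hj.least u' (hxx'.trans h1) (hyy'.trans h2)
      exact hw.least u' (hs.least u' h1 hju') (ht.least u' h2 hju')

/-- Medians are meets. -/
theorem exists_isMeet {r a b : V} (ha : Γ.Precedes r a) (hb : Γ.Precedes r b) :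
    ∃ m, Γ.IsMeet r a b m ∧ Γ.graph.dist a m + Γ.graph.dist m b = Γ.graph.dist a b := by
  obtain ⟨m, h1, h2, h3⟩ := hΓ.modular.2 r a b
  rw [Γ.graph.dist_comm (u := b) (v := m), Γ.graph.dist_comm (u := m) (v := r),
    Γ.graph.dist_comm (u := b) (v := r), add_comm] at h3
  obtain ⟨hrm, hma⟩ := hΓ.precedes_of_dist_add ha h1
  obtain ⟨-, hmb⟩ := hΓ.precedes_of_dist_add hb h3
  refine ⟨m, ⟨hrm, hma, hmb, fun c hrc hca hcb => ?_⟩, h2⟩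
  -- The join of m with a competing lower bound still lies below a and b. If it were strictly above
  -- m, passing through it would beat the geodesic from a to b through m.
  obtain ⟨j, hj⟩ := hΓ.exists_isJoin hrc hrm hca hma
  have hja := hj.least a hca hma
  have hjb := hj.least b hcb hmb
  have h4 := hΓ.dist_add hj.right hja
  have h5 := hΓ.dist_add hj.right hjb
  have h6 := hΓ.connected.dist_triangle (u := a) (v := j) (w := b)
  rw [Γ.graph.dist_comm (u := a) (v := j)] at h6
  rw [Γ.graph.dist_comm (u := a) (v := m)] at h2
  have h7 := hΓ.eq_of_dist_eq_zero (show Γ.graph.dist m j = 0 by omega)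
  rw [h7]
  exact hj.left

theorem dist_meet {r a b m : V} (h : Γ.IsMeet r a b m) :
    Γ.graph.dist a m + Γ.graph.dist m b = Γ.graph.dist a b := by
  obtain ⟨m', hm', hd⟩ := hΓ.exists_isMeet (h.base.trans h.left) (h.base.trans h.right)
  obtain rfl : m = m' := hΓ.antisymm (hm'.greatest m h.base h.left h.right)
    (h.greatest m' hm'.base hm'.left hm'.right)
  exact hd

/-- In the reversed complex j is the meet of a and b relative to the base j. -/
theorem dist_join {a b j : V} (h : Γ.IsJoin a b j) :
    Γ.graph.dist a j + Γ.graph.dist j b = Γ.graph.dist a b := by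
  obtain ⟨m, hm, hd⟩ := hΓ.reverse.exists_isMeet (precedes_reverse.2 h.left)
    (precedes_reverse.2 h.right)
  obtain rfl : m = j := hΓ.antisymm (precedes_reverse.1 hm.base)
    (h.least m (precedes_reverse.1 hm.left) (precedes_reverse.1 hm.right))
  exact hd

/-- The principal filters are convex. -/
theorem precedes_of_mem_interval {r x y m : V} (hx : Γ.Precedes r x) (hy : Γ.Precedes r y)
    (hd : Γ.graph.dist x m + Γ.graph.dist m y = Γ.graph.dist x y) : Γ.Precedes r m := by
  induction hn : Γ.graph.dist x y using Nat.strong_induction_on generalizing x m with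
  | _ n ih =>
    subst hn
    by_cases hxm : m = x
    · rwa [hxm]
    obtain ⟨z, hz, hzd⟩ := hΓ.exists_adj_dist hxm
    have tri := hΓ.connected.dist_triangle (u := z) (v := m) (w := y)
    have hadj := hΓ.dist_adj y hz
    rw [Γ.graph.dist_comm (u := m) (v := z), Γ.graph.dist_comm (u := m) (v := x)] at hzd
    rw [Γ.graph.dist_comm (u := y) (v := z), Γ.graph.dist_comm (u := y) (v := x)] at hadj
    have hzy : Γ.graph.dist z y + 1 = Γ.graph.dist x y := by omega
    -- It is enough to treat the first step z of a geodesic from x to m, since induction handles the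
    -- shorter interval from z to y.
    suffices h : Γ.Precedes r z from ih (Γ.graph.dist z y) (by omega) h (by omega) rfl
    by_cases hxz : Γ.below x z
    · exact hx.tail hxz
    rw [not_below_iff hz.symm] at hxz
    obtain ⟨c, hc, hcd⟩ := hΓ.exists_isMeet hx hy
    by_cases hcx : c = x
    · subst hcx
      have := (hΓ.precedes_of_dist_add (x := z) hc.right (by
        rw [SimpleGraph.dist_eq_one_iff_adj.2 hz.symm]; omega)).1
      exact hx.trans this
    obtain ⟨x', hx', hx'd⟩ := hΓ.exists_adj_dist hcx
    obtain ⟨hx'x, hcx'⟩ := hΓ.below_of_dist hc.left hx' hx'd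
    by_cases hzx' : z = x'
    · rw [hzx']
      exact hc.base.trans hcx'
    have tri' := hΓ.connected.dist_triangle (u := x') (v := c) (w := y)
    have hadj' := hΓ.dist_adj y hx'
    rw [Γ.graph.dist_comm (u := y) (v := x'), Γ.graph.dist_comm (u := y) (v := x)] at hadj'
    rw [Γ.graph.dist_comm (u := x) (v := c)] at hcd
    rw [Γ.graph.dist_comm (u := x') (v := c)] at tri'
    have hx'y : Γ.graph.dist x' y + 1 = Γ.graph.dist x y := by omega
    -- Both z and x' lie below x and are nearer to y. Their common neighbour t lies between x' and
    -- y, hence above r by induction, and admissibility puts t below z.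
    obtain ⟨t, ht, htd⟩ := hΓ.quadrangle (p := y) hz hx' hzx'
      (by rw [Γ.graph.dist_comm (u := y), Γ.graph.dist_comm (u := y)]; omega)
      (by rw [Γ.graph.dist_comm (u := y), Γ.graph.dist_comm (u := y)]; omega)
    rw [Γ.graph.dist_comm (u := y), Γ.graph.dist_comm (u := y)] at htd
    have htz : Γ.below t z := (hΓ.admissible _ _ _ _ ht).2 hx'x
    have hrt : Γ.Precedes r t := by
      refine ih (Γ.graph.dist x' y) (by omega) (hc.base.trans hcx') ?_ rfl
      rw [SimpleGraph.dist_eq_one_iff_adj.2 ht.2.2.2.1]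
      omega
    exact hrt.tail htz

/-- Pairwise bounded triples are bounded. -/
theorem exists_upper_of_triple {a b c u v w : V} (hau : Γ.Precedes a u) (hbu : Γ.Precedes b u)
    (hav : Γ.Precedes a v) (hcv : Γ.Precedes c v) (hbw : Γ.Precedes b w) (hcw : Γ.Precedes c w) :
    ∃ m, Γ.Precedes a m ∧ Γ.Precedes b m ∧ Γ.Precedes c m := by
  -- The median lies between two upper bounds of each of a, b and c, so convexity of filters applies
  -- three times.
  obtain ⟨m, h1, h2, h3⟩ := hΓ.modular.2 u v w
  exact ⟨m, hΓ.precedes_of_mem_interval hau hav h1, hΓ.precedes_of_mem_interval hbw hbu h3,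
    hΓ.precedes_of_mem_interval hcv hcw h2⟩

/-! ### The weighted metric -/

theorem len_eq_of_isFourCycle {u v v' u' : V} (h : Γ.graph.IsFourCycle u v v' u') :
    Γ.len s(u, v) = Γ.len s(u', v') :=
  hΓ.orbitInvariant _ h.1 _ h.2.2.1.symm
    (Relation.ReflTransGen.single ⟨u, v, v', u', h, rfl, rfl⟩)

theorem exists_walk (p q : V) : ∃ w : Γ.graph.Walk p q, w.length = Γ.graph.dist p q :=
  (hΓ.connected p q).exists_walk_length_eq_dist

/-- Two geodesics with different first steps are compared with geodesics through the opposite corner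
of a 4-cycle, whose opposite edges have equal length by orbit invariance. -/
theorem weight_eq_of_length {p q : V} (w w' : Γ.graph.Walk p q)
    (hw : w.length = Γ.graph.dist p q) (hw' : w'.length = Γ.graph.dist p q) :
    w.weight Γ.len = w'.weight Γ.len := by
  induction hn : Γ.graph.dist p q generalizing p with
  | zero =>
    obtain rfl := hΓ.eq_of_dist_eq_zero hn
    rw [hn] at hw hw'
    cases w with
    | cons => simp at hw
    | nil =>
      cases w' with
      | cons => simp at hw'
      | nil => rfl
  | succ n ih =>
    cases w with
    | nil => simp at hn
    | @cons _ s _ h w =>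
    cases w' with
    | nil => simp at hn
    | @cons _ s' _ h' w' =>
    rw [SimpleGraph.Walk.length_cons] at hw hw'
    have h1 := SimpleGraph.dist_le w
    have h1' := SimpleGraph.dist_le w'
    have h2 := hΓ.dist_adj q h
    have h2' := hΓ.dist_adj q h'
    rw [Γ.graph.dist_comm (u := q), Γ.graph.dist_comm (u := q)] at h2 h2'
    have h3 : Γ.graph.dist s q = n := by omega
    have h3' : Γ.graph.dist s' q = n := by omega
    simp only [SimpleGraph.Walk.weight_cons]
    by_cases hss : s = s'
    · subst hss
      rw [ih w w' (by omega) (by omega) h3]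
    · obtain ⟨t, ht, htd⟩ := hΓ.quadrangle (p := q) h.symm h'.symm hss
        (by rw [Γ.graph.dist_comm (u := q), Γ.graph.dist_comm (u := q)]; omega)
        (by rw [Γ.graph.dist_comm (u := q), Γ.graph.dist_comm (u := q)]; omega)
      rw [Γ.graph.dist_comm (u := q), Γ.graph.dist_comm (u := q)] at htd
      obtain ⟨w₀, hw₀⟩ := hΓ.exists_walk t q
      rw [ih w (.cons ht.1.symm w₀) (by omega)
          (by rw [SimpleGraph.Walk.length_cons]; omega) h3,
        ih w' (.cons ht.2.2.2.1 w₀) (by omega)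
          (by rw [SimpleGraph.Walk.length_cons]; omega) h3']
      simp only [SimpleGraph.Walk.weight_cons]
      have e1 := hΓ.len_eq_of_isFourCycle ht
      have e2 := hΓ.len_eq_of_isFourCycle (u := t) (v := s') (v' := p) (u' := s)
        ⟨ht.2.2.2.1.symm, h'.symm, h, ht.1.symm, ht.2.2.2.2.1, Ne.symm hss⟩
      rw [Sym2.eq_swap (a := s) (b := t), e1, Sym2.eq_swap (a := s') (b := t), e2,
        Sym2.eq_swap (a := p) (b := s'), Sym2.eq_swap (a := p) (b := s)]
      ring

/-- Geodesics for the edge count also minimize weight. If the competitor's first edge leads away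
from the target, that edge followed by w is a geodesic from its other end, and positivity finishes.
-/
theorem weight_le {p q : V} (w w' : Γ.graph.Walk p q) (hw : w.length = Γ.graph.dist p q) :
    w.weight Γ.len ≤ w'.weight Γ.len := by
  induction w' with
  | nil =>
    rw [SimpleGraph.dist_self] at hw
    cases w with
    | cons => simp at hw
    | nil => exact le_rfl
  | @cons p s q h w' ih =>
    rw [SimpleGraph.Walk.weight_cons]
    obtain ⟨w₀, hw₀⟩ := hΓ.exists_walk s q
    have h1 := ih w₀ hw₀
    have h2 := hΓ.dist_adj q h
    rw [Γ.graph.dist_comm (u := q), Γ.graph.dist_comm (u := q)] at h2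
    rcases h2 with h2 | h2
    · rw [hΓ.weight_eq_of_length w₀ (.cons h.symm w) hw₀
        (by rw [SimpleGraph.Walk.length_cons]; omega), SimpleGraph.Walk.weight_cons] at h1
      have h3 := hΓ.pos s(p, s) h
      have h4 := hΓ.pos s(s, p) h.symm
      linarith
    · rw [hΓ.weight_eq_of_length w (.cons h w₀) hw
        (by rw [SimpleGraph.Walk.length_cons]; omega), SimpleGraph.Walk.weight_cons]
      linarith

theorem weightedDist_eq_weight {p q : V} (w : Γ.graph.Walk p q)
    (hw : w.length = Γ.graph.dist p q) : Γ.graph.weightedDist Γ.len p q = w.weight Γ.len :=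
  SimpleGraph.weightedDist_eq (fun w' => hΓ.weight_le w w' hw) ⟨w, le_rfl⟩

theorem weightedDist_add {p x q : V}
    (h : Γ.graph.dist p x + Γ.graph.dist x q = Γ.graph.dist p q) :
    Γ.graph.weightedDist Γ.len p x + Γ.graph.weightedDist Γ.len x q =
      Γ.graph.weightedDist Γ.len p q := by
  obtain ⟨w, hw⟩ := hΓ.exists_walk p x
  obtain ⟨w', hw'⟩ := hΓ.exists_walk x q
  rw [hΓ.weightedDist_eq_weight w hw, hΓ.weightedDist_eq_weight w' hw',
    hΓ.weightedDist_eq_weight (w.append w') (by rw [SimpleGraph.Walk.length_append]; omega),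
    SimpleGraph.Walk.weight_append]

theorem weightedDist_comm (p q : V) :
    Γ.graph.weightedDist Γ.len p q = Γ.graph.weightedDist Γ.len q p := by
  obtain ⟨w, hw⟩ := hΓ.exists_walk p q
  rw [hΓ.weightedDist_eq_weight w hw, hΓ.weightedDist_eq_weight w.reverse
    (by rw [SimpleGraph.Walk.length_reverse, hw, Γ.graph.dist_comm]),
    SimpleGraph.Walk.weight_reverse]

theorem weightedDist_adj {p q : V} (h : Γ.graph.Adj p q) :
    Γ.graph.weightedDist Γ.len p q = Γ.len s(p, q) := by
  rw [hΓ.weightedDist_eq_weight (.cons h .nil)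
    (by simp [SimpleGraph.dist_eq_one_iff_adj.2 h]), SimpleGraph.Walk.weight_cons,
    SimpleGraph.Walk.weight_nil, add_zero]

theorem weightedDist_self (p : V) : Γ.graph.weightedDist Γ.len p p = 0 := by
  rw [hΓ.weightedDist_eq_weight .nil (by simp), SimpleGraph.Walk.weight_nil]

theorem weightedDist_nonneg (p q : V) : 0 ≤ Γ.graph.weightedDist Γ.len p q := by
  obtain ⟨w, hw⟩ := hΓ.exists_walk p q
  rw [hΓ.weightedDist_eq_weight w hw]
  refine List.sum_nonneg fun x hx => ?_
  obtain ⟨e, he, rfl⟩ := List.mem_map.1 hx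
  exact (hΓ.pos e (w.edges_subset_edgeSet he)).le

theorem weightedDist_pos {p q : V} (h : p ≠ q) : 0 < Γ.graph.weightedDist Γ.len p q := by
  obtain ⟨y, hy, hd⟩ := hΓ.exists_adj_dist h
  rw [← hΓ.weightedDist_add (x := y) (by rw [SimpleGraph.dist_eq_one_iff_adj.2 hy, hd]),
    hΓ.weightedDist_adj hy]
  linarith [hΓ.weightedDist_nonneg p y, hΓ.pos s(y, q) hy]

theorem weightedDist_le_add (r : V) {p q : V} (h : Γ.graph.Adj p q) :
    Γ.graph.weightedDist Γ.len r p ≤ Γ.len s(p, q) + Γ.graph.weightedDist Γ.len r q := by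
  have h1 := SimpleGraph.dist_eq_one_iff_adj.2 h
  have h2 := hΓ.weightedDist_adj h
  have h3 := hΓ.pos s(p, q) h
  rcases hΓ.dist_adj r h with h' | h'
  · have := hΓ.weightedDist_add (p := r) (x := p) (q := q) (by omega)
    linarith
  · rw [Γ.graph.dist_comm] at h1
    have := hΓ.weightedDist_add (p := r) (x := q) (q := p) (by omega)
    rw [hΓ.weightedDist_comm q p] at this
    linarith

theorem weightedDist_precedes {r a b : V} (h : Γ.Precedes r a) (h' : Γ.Precedes a b) :
    Γ.graph.weightedDist Γ.len r a + Γ.graph.weightedDist Γ.len a b =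
      Γ.graph.weightedDist Γ.len r b :=
  hΓ.weightedDist_add (hΓ.dist_add h h')

/-- The distance from `r` is a modular valuation. -/
theorem weightedDist_join_add_meet {r a b j m : V} (hj : Γ.IsJoin a b j)
    (hm : Γ.IsMeet r a b m) :
    Γ.graph.weightedDist Γ.len r j + Γ.graph.weightedDist Γ.len r m =
      Γ.graph.weightedDist Γ.len r a + Γ.graph.weightedDist Γ.len r b := by
  have ha := hm.base.trans hm.left
  have hb := hm.base.trans hm.right
  have h1 := hΓ.weightedDist_precedes hm.base hm.left
  have h2 := hΓ.weightedDist_precedes hm.base hm.right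
  have h3 := hΓ.weightedDist_precedes ha hj.left
  have h4 := hΓ.weightedDist_precedes hb hj.right
  have h5 := hΓ.weightedDist_add (hΓ.dist_meet hm)
  have h6 := hΓ.weightedDist_add (hΓ.dist_join hj)
  rw [hΓ.weightedDist_comm a m] at h5
  rw [hΓ.weightedDist_comm j b] at h6
  linarith

theorem dist_join_add_meet {r a b j m : V} (hj : Γ.IsJoin a b j) (hm : Γ.IsMeet r a b m) :
    Γ.graph.dist r j + Γ.graph.dist r m = Γ.graph.dist r a + Γ.graph.dist r b := by
  have ha := hm.base.trans hm.left
  have hb := hm.base.trans hm.right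
  have h1 := hΓ.dist_add hm.base hm.left
  have h2 := hΓ.dist_add hm.base hm.right
  have h3 := hΓ.dist_add ha hj.left
  have h4 := hΓ.dist_add hb hj.right
  have h5 := hΓ.dist_meet hm
  have h6 := hΓ.dist_join hj
  rw [Γ.graph.dist_comm (u := a) (v := m)] at h5
  rw [Γ.graph.dist_comm (u := j) (v := b)] at h6
  omega

theorem weightedDist_le_of_precedes {r a b : V} (h : Γ.Precedes r a) (h' : Γ.Precedes a b) :
    Γ.graph.weightedDist Γ.len r a ≤ Γ.graph.weightedDist Γ.len r b ∧
      (a ≠ b → Γ.graph.weightedDist Γ.len r a < Γ.graph.weightedDist Γ.len r b) := by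
  have h1 := hΓ.weightedDist_precedes h h'
  have h2 := hΓ.weightedDist_nonneg a b
  exact ⟨by linarith, fun hne => by linarith [hΓ.weightedDist_pos hne]⟩

theorem exists_isJoin_three {z a b c u : V} (hza : Γ.Precedes z a) (hzb : Γ.Precedes z b)
    (hzc : Γ.Precedes z c) (hau : Γ.Precedes a u) (hbu : Γ.Precedes b u) (hcu : Γ.Precedes c u) :
    ∃ m j, Γ.IsJoin a b m ∧ Γ.IsJoin m c j := by
  obtain ⟨m, hm⟩ := hΓ.exists_isJoin hza hzb hau hbu
  obtain ⟨j, hj⟩ := hΓ.exists_isJoin (hza.trans hm.left) hzc (hm.least u hau hbu) hcu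
  exact ⟨m, j, hm, hj⟩

end IsModularComplex

end OrientedLengthGraph

/-! ### Boolean pairs -/

namespace OrientedLengthGraph

variable {V : Type*} {Γ : OrientedLengthGraph V}

/-- Cubes may be indexed by arbitrary finite types. -/
theorem isBoolean_of_cube {ι : Type*} [Fintype ι] [DecidableEq ι] (φ : Finset ι → V)
    (hinj : Function.Injective φ)
    (hstep : ∀ (S : Finset ι) (i : ι), i ∉ S → Γ.below (φ S) (φ (insert i S))) :
    Γ.IsBoolean (φ ∅) (φ Finset.univ) := by
  classical
  let e := (Fintype.equivFin ι).symm
  refine ⟨Fintype.card ι, ⟨fun S => φ (S.map e.toEmbedding),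
    hinj.comp (Finset.map_injective _)⟩, fun S i hi => ?_, ?_, ?_⟩
  · show Γ.below (φ (S.map e.toEmbedding)) (φ ((insert i S).map e.toEmbedding))
    rw [Finset.map_insert]
    exact hstep _ _ (by simpa using hi)
  · show φ _ = φ _
    simp
  · show φ _ = φ _
    simp

theorem precedes_of_cube {n : ℕ} {φ : Finset (Fin n) ↪ V}
    (hstep : ∀ (S : Finset (Fin n)) (i : Fin n), i ∉ S → Γ.below (φ S) (φ (insert i S)))
    {S T : Finset (Fin n)} (h : S ⊆ T) : Γ.Precedes (φ S) (φ T) := by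
  have key : ∀ D, Γ.Precedes (φ S) (φ (S ∪ D)) := by
    intro D
    induction D using Finset.induction_on with
    | empty =>
      rw [Finset.union_empty]
      exact Precedes.refl _
    | insert i D _ ih =>
      rw [Finset.union_insert]
      by_cases hi : i ∈ S ∪ D
      · rwa [Finset.insert_eq_of_mem hi]
      · exact ih.tail (hstep _ i hi)
  have := key T
  rwa [Finset.union_eq_right.2 h] at this

theorem IsBoolean.precedes {p q : V} (h : Γ.IsBoolean p q) : Γ.Precedes p q := by
  obtain ⟨n, φ, hstep, rfl, rfl⟩ := h
  exact precedes_of_cube hstep (Finset.empty_subset _)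

theorem IsBoolean.reverse {p q : V} (h : Γ.IsBoolean p q) : Γ.reverse.IsBoolean q p := by
  obtain ⟨n, φ, hstep, rfl, rfl⟩ := h
  have := isBoolean_of_cube (Γ := Γ.reverse) (fun S => φ Sᶜ)
    (φ.injective.comp compl_injective) (fun S i hi => by
      show Γ.below (φ (insert i S)ᶜ) (φ Sᶜ)
      have h1 : Sᶜ = insert i (insert i S)ᶜ := by
        ext x
        simp only [Finset.mem_compl, Finset.mem_insert]
        by_cases hx : x = i
        · simp [hx, hi]
        · simp [hx]
      rw [h1]
      exact hstep _ i (by simp))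
  simpa using this

theorem isBoolean_reverse {p q : V} : Γ.reverse.IsBoolean q p ↔ Γ.IsBoolean p q :=
  ⟨fun h => h.reverse, fun h => h.reverse⟩

/-- `q` is the join of elements covering `p`. -/
def IsAtomJoin (Γ : OrientedLengthGraph V) (p q : V) : Prop :=
  Γ.Precedes p q ∧ ∀ u, Γ.Precedes p u →
    (∀ x, Γ.below p x → Γ.Precedes x q → Γ.Precedes x u) → Γ.Precedes q u

/-- `j` is the least upper bound of `p` and the elements of `S`. -/
structure IsFinJoin (Γ : OrientedLengthGraph V) (p : V) (S : Finset V) (j : V) : Prop where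
  base : Γ.Precedes p j
  upper : ∀ x ∈ S, Γ.Precedes x j
  least : ∀ u, Γ.Precedes p u → (∀ x ∈ S, Γ.Precedes x u) → Γ.Precedes j u

theorem IsAtomJoin.trans_isJoin {p q q' j : V} (h : Γ.IsAtomJoin p q) (h' : Γ.IsAtomJoin p q')
    (hj : Γ.IsJoin q q' j) : Γ.IsAtomJoin p j :=
  ⟨h.1.trans hj.left, fun u hu hx => hj.least u
    (h.2 u hu fun x h1 h2 => hx x h1 (h2.trans hj.left))
    (h'.2 u hu fun x h1 h2 => hx x h1 (h2.trans hj.right))⟩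

namespace IsModularComplex

variable (hΓ : Γ.IsModularComplex)
include hΓ

/-- For S with at least two elements, φ S is the join of two of its facets, as these cover a common
vertex. Induction on |S| puts every cube vertex below any bound of the atoms. -/
theorem isAtomJoin_of_isBoolean {p q : V} (h : Γ.IsBoolean p q) : Γ.IsAtomJoin p q := by
  refine ⟨h.precedes, fun u hpu hu => ?_⟩
  obtain ⟨n, φ, hstep, rfl, rfl⟩ := h
  suffices key : ∀ S, Γ.Precedes (φ S) u from key _
  intro S
  induction hk : S.card using Nat.strong_induction_on generalizing S with
  | _ k ih =>
    subst hk
    rcases S.eq_empty_or_nonempty with rfl | ⟨i, hi⟩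
    · exact hpu
    rcases (S.erase i).eq_empty_or_nonempty with he | ⟨j, hj⟩
    · have hS : S = insert i ∅ := by rw [← he, Finset.insert_erase hi]
      rw [hS]
      exact hu _ (hstep ∅ i (by simp)) (precedes_of_cube hstep (Finset.subset_univ _))
    · set T := (S.erase i).erase j with hT
      have hjS := Finset.mem_of_mem_erase hj
      have hij := Finset.ne_of_mem_erase hj
      have hS1 : S.erase i = insert j T := (Finset.insert_erase hj).symm
      have hS2 : S.erase j = insert i T := by
        rw [hT, Finset.erase_right_comm, Finset.insert_erase (Finset.mem_erase.2 ⟨hij.symm, hi⟩)]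
      have hjT : j ∉ T := Finset.notMem_erase _ _
      have hiT : i ∉ T := fun h' => Finset.notMem_erase i S (Finset.mem_of_mem_erase h')
      have h1 : Γ.below (φ (S.erase i)) (φ S) := by
        have := hstep (S.erase i) i (Finset.notMem_erase _ _)
        rwa [Finset.insert_erase hi] at this
      have h2 : Γ.below (φ (S.erase j)) (φ S) := by
        have := hstep (S.erase j) j (Finset.notMem_erase _ _)
        rwa [Finset.insert_erase hjS] at this
      have h3 := ih _ (Finset.card_erase_lt_of_mem hi) _ rfl
      have h4 := ih _ (Finset.card_erase_lt_of_mem hjS) _ rfl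
      have h5 : Γ.below (φ T) (φ (S.erase i)) := by rw [hS1]; exact hstep T j hjT
      have h6 : Γ.below (φ T) (φ (S.erase j)) := by rw [hS2]; exact hstep T i hiT
      have hne : φ (S.erase i) ≠ φ (S.erase j) := fun h' => by
        have h7 := φ.injective h'
        have : j ∈ S.erase j := h7 ▸ hj
        simp at this
      obtain ⟨w, hw, hw1, hw2⟩ := hΓ.exists_isJoin_of_below h5 h6 hne h3 h4
      have h8 := hw.least _ (.of_below h1) (.of_below h2)
      have h9 := hΓ.dist_add (.of_below hw1) h8
      rw [dist_eq_one_of_below h1, dist_eq_one_of_below hw1] at h9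
      have h10 := hΓ.eq_of_dist_eq_zero (show Γ.graph.dist w (φ S) = 0 by omega)
      rw [← h10]
      exact hw.least u h3 h4

/-- The join with an element covering the base is trivial or a covering. -/
theorem eq_or_below_of_isJoin {p x s j : V} (hx : Γ.below p x) (hs : Γ.Precedes p s)
    (hj : Γ.IsJoin s x j) : j = s ∨ Γ.below s j := by
  obtain ⟨m, hm, -⟩ := hΓ.exists_isMeet hs (.of_below hx)
  have h1 := hΓ.dist_join_add_meet hj hm
  have h2 := hΓ.dist_add hm.base hm.right
  have h3 := hΓ.dist_add hs hj.left
  rw [dist_eq_one_of_below hx] at h1 h2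
  by_cases h : Γ.graph.dist s j = 0
  · exact Or.inl (hΓ.eq_of_dist_eq_zero h).symm
  · exact Or.inr (hΓ.below_of_precedes hj.left (by omega))

theorem exists_isFinJoin {p q : V} (hpq : Γ.Precedes p q) (S : Finset V)
    (hS : ∀ x ∈ S, Γ.below p x ∧ Γ.Precedes x q) : ∃ j, Γ.IsFinJoin p S j := by
  classical
  induction S using Finset.induction_on with
  | empty => exact ⟨p, Precedes.refl p, by simp, fun u hu _ => hu⟩
  | insert a S _ ih =>
    obtain ⟨s, hs⟩ := ih fun x hx => hS x (Finset.mem_insert_of_mem hx)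
    obtain ⟨ha, haq⟩ := hS a (Finset.mem_insert_self _ _)
    have hsq := hs.least q hpq fun x hx => (hS x (Finset.mem_insert_of_mem hx)).2
    obtain ⟨j, hj⟩ := hΓ.exists_isJoin hs.base (.of_below ha) hsq haq
    refine ⟨j, hs.base.trans hj.left, fun x hx => ?_, fun u hu hxu => ?_⟩
    · rcases Finset.mem_insert.1 hx with rfl | hx
      · exact hj.right
      · exact (hs.upper x hx).trans hj.left
    · exact hj.least u (hs.least u hu fun x hx => hxu x (Finset.mem_insert_of_mem hx))
        (hxu a (Finset.mem_insert_self _ _))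

/-- A smallest set of covers of p with join q is independent: none of its elements lies below the
join of the others. Hence the joins of its subsets are distinct, each added element is a covering
step, and these joins form the cube. -/
theorem isBoolean_of_isAtomJoin [Finite V] {p q : V} (h : Γ.IsAtomJoin p q) :
    Γ.IsBoolean p q := by
  classical
  obtain ⟨hpq, hq⟩ := h
  let P : Finset V → Prop := fun A =>
    (∀ x ∈ A, Γ.below p x ∧ Γ.Precedes x q) ∧ Γ.IsFinJoin p A q
  have hex : ∃ A, P A := by
    have hfin : {x | Γ.below p x ∧ Γ.Precedes x q}.Finite := Set.toFinite _
    have hmem : ∀ x, x ∈ hfin.toFinset ↔ Γ.below p x ∧ Γ.Precedes x q := fun x =>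
      Set.Finite.mem_toFinset hfin
    exact ⟨hfin.toFinset, fun x hx => (hmem x).1 hx, hpq, fun x hx => ((hmem x).1 hx).2,
      fun u hu hxu => hq u hu fun x h1 h2 => hxu x ((hmem x).2 ⟨h1, h2⟩)⟩
  obtain ⟨A, ⟨hA, hAq⟩, hmin⟩ := WellFounded.has_min (measure Finset.card).wf {A | P A} hex
  -- The implication makes the join a total function; its values off subsets of A are irrelevant.
  have hJ : ∀ S : Finset V, ∃ j, S ⊆ A → Γ.IsFinJoin p S j := by
    intro S
    by_cases hSA : S ⊆ A
    · obtain ⟨j, hj⟩ := hΓ.exists_isFinJoin hpq S fun x hx => hA x (hSA hx)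
      exact ⟨j, fun _ => hj⟩
    · exact ⟨p, fun h => absurd h hSA⟩
  choose J hJ using hJ
  have mono : ∀ {S T : Finset V}, S ⊆ T → T ⊆ A → Γ.Precedes (J S) (J T) := fun hST hT =>
    (hJ _ (hST.trans hT)).least _ (hJ _ hT).base fun x hx => (hJ _ hT).upper x (hST hx)
  have hnot : ∀ i ∈ A, ¬ Γ.Precedes i (J (A.erase i)) := by
    intro i hi hle
    have hE := hJ (A.erase i) (Finset.erase_subset _ _)
    have h1 : Γ.Precedes q (J (A.erase i)) := hAq.least _ hE.base fun x hx => by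
      by_cases hxi : x = i
      · rwa [hxi]
      · exact hE.upper x (Finset.mem_erase.2 ⟨hxi, hx⟩)
    have h2 : Γ.Precedes (J (A.erase i)) q :=
      hE.least q hpq fun x hx => (hA x (Finset.mem_of_mem_erase hx)).2
    have h3 := hΓ.antisymm h1 h2
    rw [← h3] at hE
    exact hmin (A.erase i) ⟨fun x hx => hA x (Finset.mem_of_mem_erase hx), hE⟩
      (Finset.card_erase_lt_of_mem hi)
  have hnot' : ∀ {S : Finset V} {i : V}, S ⊆ A → i ∈ A → i ∉ S → ¬ Γ.Precedes i (J S) := by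
    intro S i hS hi hiS hle
    refine hnot i hi (hle.trans (mono (fun x hx => Finset.mem_erase.2 ⟨?_, hS hx⟩)
      (Finset.erase_subset _ _)))
    rintro rfl
    exact hiS hx
  have hinj : ∀ {S T : Finset V}, S ⊆ A → T ⊆ A → J S = J T → S ⊆ T := by
    intro S T hS hT he i hi
    by_contra hiT
    refine hnot' hT (hS hi) hiT ?_
    rw [← he]
    exact (hJ S hS).upper i hi
  have hmapA : ∀ S : Finset A, S.map (Function.Embedding.subtype _) ⊆ A := by
    intro S x hx
    obtain ⟨y, -, rfl⟩ := Finset.mem_map.1 hx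
    exact y.2
  have := isBoolean_of_cube (Γ := Γ) (ι := A)
    (fun S => J (S.map (Function.Embedding.subtype _)))
    (fun S T he => Finset.map_injective (Function.Embedding.subtype _)
      ((hinj (hmapA S) (hmapA T) he).antisymm (hinj (hmapA T) (hmapA S) he.symm)))
    (fun S i hi => by
      have h1 := hmapA (insert i S)
      rw [Finset.map_insert] at h1 ⊢
      have hS := hJ _ (hmapA S)
      have hiS := hJ _ h1
      have hi' : (i : V) ∉ S.map (Function.Embedding.subtype _) := by simpa using hi
      have hjoin : Γ.IsJoin (J (S.map (Function.Embedding.subtype _))) i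
          (J (insert (i : V) (S.map (Function.Embedding.subtype _)))) :=
        ⟨mono (Finset.subset_insert _ _) h1, hiS.upper _ (Finset.mem_insert_self _ _),
          fun u hu hiu => hiS.least u (hS.base.trans hu) fun x hx => by
            rcases Finset.mem_insert.1 hx with rfl | hx
            · exact hiu
            · exact (hS.upper x hx).trans hu⟩
      rcases hΓ.eq_or_below_of_isJoin (hA i i.2).1 hS.base hjoin with h | h
      · have := hjoin.right
        rw [h] at this
        exact absurd this (hnot' (hmapA S) i.2 hi')
      · exact h)
  have e1 : J ((∅ : Finset A).map (Function.Embedding.subtype _)) = p := by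
    have h1 := hJ _ (hmapA ∅)
    exact hΓ.antisymm (h1.least p (Precedes.refl p) (by simp)) h1.base
  have e2 : J ((Finset.univ : Finset A).map (Function.Embedding.subtype _)) = q := by
    have h1 := hJ _ (hmapA Finset.univ)
    have h2 : (Finset.univ : Finset A).map (Function.Embedding.subtype _) = A := by
      ext x
      simp
    rw [h2] at h1 ⊢
    exact hΓ.antisymm (h1.least q hpq hAq.upper) (hAq.least _ h1.base h1.upper)
  rwa [e1, e2] at this

theorem isBoolean_iff_isAtomJoin [Finite V] {p q : V} : Γ.IsBoolean p q ↔ Γ.IsAtomJoin p q :=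
  ⟨hΓ.isAtomJoin_of_isBoolean, hΓ.isBoolean_of_isAtomJoin⟩

/-- Joining a with a cover x of p below q gives either a itself or a cover of a below q, so the
covers of a still generate q. -/
theorem isBoolean_upper [Finite V] {p a q : V} (h : Γ.IsBoolean p q) (hpa : Γ.Precedes p a)
    (haq : Γ.Precedes a q) : Γ.IsBoolean a q := by
  rw [hΓ.isBoolean_iff_isAtomJoin] at h ⊢
  refine ⟨haq, fun u hau hu => h.2 u (hpa.trans hau) fun x hx hxq => ?_⟩
  obtain ⟨j, hj⟩ := hΓ.exists_isJoin hpa (.of_below hx) haq hxq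
  rcases hΓ.eq_or_below_of_isJoin hx hpa hj with rfl | hlt
  · exact hj.right.trans hau
  · exact hj.right.trans (hu j hlt (hj.least q haq hxq))

theorem isBoolean_lower [Finite V] {p a q : V} (h : Γ.IsBoolean p q) (hpa : Γ.Precedes p a)
    (haq : Γ.Precedes a q) : Γ.IsBoolean p a :=
  isBoolean_reverse.1 (hΓ.reverse.isBoolean_upper (isBoolean_reverse.2 h)
    (precedes_reverse.2 haq) (precedes_reverse.2 hpa))

/-- Boolean pairs are inherited by subintervals. -/
theorem isBoolean_mono [Finite V] {p a b q : V} (h : Γ.IsBoolean p q) (hpa : Γ.Precedes p a)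
    (hab : Γ.Precedes a b) (hbq : Γ.Precedes b q) : Γ.IsBoolean a b :=
  hΓ.isBoolean_lower (hΓ.isBoolean_upper h hpa (hab.trans hbq)) hab hbq

theorem isBoolean_isJoin [Finite V] {p q q' j : V} (h : Γ.IsBoolean p q) (h' : Γ.IsBoolean p q')
    (hj : Γ.IsJoin q q' j) : Γ.IsBoolean p j := by
  rw [hΓ.isBoolean_iff_isAtomJoin] at *
  exact h.trans_isJoin h' hj

theorem isBoolean_isJoin_reverse [Finite V] {p q q' j : V} (h : Γ.IsBoolean q p)
    (h' : Γ.IsBoolean q' p) (hj : Γ.reverse.IsJoin q q' j) : Γ.IsBoolean j p :=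
  isBoolean_reverse.1 (hΓ.reverse.isBoolean_isJoin h.reverse h'.reverse hj)

theorem isBoolean_of_below [Finite V] {p q : V} (h : Γ.below p q) : Γ.IsBoolean p q :=
  hΓ.isBoolean_of_isAtomJoin ⟨.of_below h, fun _ _ hu => hu q h (Precedes.refl q)⟩

end IsModularComplex

end OrientedLengthGraph

/-! ### Neighborhood semilattices -/

namespace OrientedLengthGraph

variable {V : Type*} {Γ : OrientedLengthGraph V}

theorem Precedes.of_subdivision {a b : Γ.BooleanPair} (h : Γ.subdivision.Precedes a b) :
    Γ.Precedes b.lo a.lo ∧ Γ.Precedes a.hi b.hi := by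
  induction h with
  | refl => exact ⟨Precedes.refl _, Precedes.refl _⟩
  | tail _ h ih =>
    rcases h with ⟨h, h'⟩ | ⟨h, h'⟩
    · exact ⟨h ▸ ih.1, ih.2.tail h'⟩
    · exact ⟨(Precedes.of_below h').trans ih.1, h ▸ ih.2⟩

theorem subdivision_len_of_lo_eq {a b : Γ.BooleanPair} (h : a.lo = b.lo) :
    Γ.subdivision.len s(a, b) = Γ.len s(a.hi, b.hi) / 2 :=
  if_pos h

theorem subdivision_len_of_lo_ne {a b : Γ.BooleanPair} (h : a.lo ≠ b.lo) :
    Γ.subdivision.len s(a, b) = Γ.len s(a.lo, b.lo) / 2 :=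
  if_neg h

namespace IsModularComplex

variable (hΓ : Γ.IsModularComplex)
include hΓ

/-! ### The valuation of a neighborhood semilattice -/

/-- Along an edge of Γ* one end of the pair moves, so the half-sum of distances from r changes by at
most the edge length. Ascending paths from r/r attain the resulting bound. -/
theorem halfDist_le_weight (r : V) {a b : Γ.BooleanPair} (w : Γ.subdivision.graph.Walk a b) :
    (Γ.graph.weightedDist Γ.len r a.hi + Γ.graph.weightedDist Γ.len r a.lo) / 2 ≤
      w.weight Γ.subdivision.len +
        (Γ.graph.weightedDist Γ.len r b.hi + Γ.graph.weightedDist Γ.len r b.lo) / 2 := by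
  induction w with
  | nil => simp [SimpleGraph.Walk.weight_nil]
  | @cons a c b h w ih =>
    rw [SimpleGraph.Walk.weight_cons]
    rcases h with ⟨h, h'⟩ | ⟨h, h'⟩
    · rw [subdivision_len_of_lo_eq h]
      have := hΓ.weightedDist_le_add r h'
      rw [← h] at ih
      linarith
    · rw [subdivision_len_of_lo_ne h'.ne]
      have := hΓ.weightedDist_le_add r h'
      rw [← h] at ih
      linarith

theorem exists_subdivision_walk (r : V) {b : Γ.BooleanPair}
    (h : Γ.subdivision.Precedes (Γ.diag r) b) :
    ∃ w : Γ.subdivision.graph.Walk b (Γ.diag r), w.weight Γ.subdivision.len =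
      (Γ.graph.weightedDist Γ.len r b.hi + Γ.graph.weightedDist Γ.len r b.lo) / 2 := by
  induction h with
  | refl => exact ⟨.nil, by
      simp [SimpleGraph.Walk.weight_nil, diag, hΓ.weightedDist_self]⟩
  | @tail a b h1 h2 ih =>
    obtain ⟨w, hw⟩ := ih
    obtain ⟨h3, h4⟩ := Precedes.of_subdivision h1
    refine ⟨.cons (adj_of_below h2).symm w, ?_⟩
    rw [SimpleGraph.Walk.weight_cons, hw]
    rcases h2 with ⟨h, h'⟩ | ⟨h, h'⟩
    · rw [subdivision_len_of_lo_eq h.symm]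
      have h5 := hΓ.weightedDist_precedes (r := r) h4 (.of_below h')
      rw [hΓ.weightedDist_adj (adj_of_below h'), Sym2.eq_swap] at h5
      rw [← h]
      linarith
    · rw [subdivision_len_of_lo_ne (adj_of_below h').ne]
      have h5 := hΓ.weightedDist_precedes (.of_below h') h3
      change _ + Γ.graph.weightedDist Γ.len _ r = Γ.graph.weightedDist Γ.len _ r at h5
      rw [hΓ.weightedDist_adj (adj_of_below h'), hΓ.weightedDist_comm _ r,
        hΓ.weightedDist_comm _ r] at h5
      rw [← h]
      linarith

theorem neighborhoodValuation_eq {r : V} (x : Γ.NeighborhoodSemilattice r) :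
    Γ.neighborhoodValuation r x =
      (Γ.graph.weightedDist Γ.len r x.1.hi + Γ.graph.weightedDist Γ.len r x.1.lo) / 2 := by
  obtain ⟨w, hw⟩ := hΓ.exists_subdivision_walk r (IsBoolean.precedes x.2)
  refine SimpleGraph.weightedDist_eq (fun w' => ?_) ⟨w, hw.le⟩
  have := hΓ.halfDist_le_weight r w'
  change _ ≤ _ +
    (Γ.graph.weightedDist Γ.len r r + Γ.graph.weightedDist Γ.len r r) / 2 at this
  rw [hΓ.weightedDist_self] at this
  linarith

variable [Finite V]

theorem subdivision_precedes_of_hi {lo c d : V} (hcd : Γ.Precedes c d) (hc : Γ.IsBoolean lo c)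
    (hd : Γ.IsBoolean lo d) : Γ.subdivision.Precedes ⟨lo, c, hc⟩ ⟨lo, d, hd⟩ := by
  induction hcd with
  | refl => exact Precedes.refl _
  | @tail y z h1 h2 ih =>
    have hy := hΓ.isBoolean_lower hd (hc.precedes.trans h1) (.of_below h2)
    exact (ih hy).tail (Or.inl ⟨rfl, h2⟩)

theorem subdivision_precedes_of_lo {c d hi : V} (hcd : Γ.Precedes c d) (hc : Γ.IsBoolean c hi)
    (hd : Γ.IsBoolean d hi) : Γ.subdivision.Precedes ⟨d, hi, hd⟩ ⟨c, hi, hc⟩ := by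
  induction hcd with
  | refl => exact Precedes.refl _
  | @tail y z h1 h2 ih =>
    have hy := hΓ.isBoolean_upper hc h1 ((Precedes.of_below h2).trans hd.precedes)
    exact Relation.ReflTransGen.head (b := (⟨y, hi, hy⟩ : Γ.BooleanPair)) (Or.inr ⟨rfl, h2⟩) (ih hy)

/-- The upper end is moved first and the lower end second; the intermediate pair is a subinterval of
b and therefore Boolean. -/
theorem subdivision_precedes_iff {a b : Γ.BooleanPair} :
    Γ.subdivision.Precedes a b ↔ Γ.Precedes b.lo a.lo ∧ Γ.Precedes a.hi b.hi := by
  refine ⟨Precedes.of_subdivision, fun ⟨h1, h2⟩ => ?_⟩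
  have h := hΓ.isBoolean_upper b.isBoolean h1 (a.isBoolean.precedes.trans h2)
  exact (hΓ.subdivision_precedes_of_hi h2 a.isBoolean h).trans
    (hΓ.subdivision_precedes_of_lo h1 b.isBoolean h)

/-- The required cube of Γ* is the product of a cube from r to the upper end with the reversal of
one from the lower end to r. -/
theorem mem_subdivision_upper_iff {r : V} {b : Γ.BooleanPair} :
    b ∈ Γ.subdivision.upper (Γ.diag r) ↔ Γ.Precedes b.lo r ∧ Γ.Precedes r b.hi := by
  constructor
  · intro h
    exact (IsBoolean.precedes h).of_subdivision
  · rintro ⟨h1, h2⟩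
    obtain ⟨m, ψ, hψ, hψ0, hψ1⟩ := hΓ.isBoolean_lower b.isBoolean h1 h2
    obtain ⟨n, φ, hφ, hφ0, hφ1⟩ := hΓ.isBoolean_upper b.isBoolean h1 h2
    have hlo : ∀ S, Γ.Precedes b.lo (ψ S) ∧ Γ.Precedes (ψ S) r := fun S => by
      rw [← hψ0, ← hψ1]
      exact ⟨precedes_of_cube hψ (Finset.empty_subset _), precedes_of_cube hψ (Finset.subset_univ _)⟩
    have hhi : ∀ S, Γ.Precedes r (φ S) ∧ Γ.Precedes (φ S) b.hi := fun S => by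
      rw [← hφ0, ← hφ1]
      exact ⟨precedes_of_cube hφ (Finset.empty_subset _), precedes_of_cube hφ (Finset.subset_univ _)⟩
    have hB : ∀ S T, Γ.IsBoolean (ψ S) (φ T) := fun S T =>
      hΓ.isBoolean_mono b.isBoolean (hlo S).1 ((hlo S).2.trans (hhi T).1) (hhi T).2
    -- Left indices raise the upper end; right indices lower the lower end, hence the complement.
    have := isBoolean_of_cube (Γ := Γ.subdivision) (ι := Fin n ⊕ Fin m)
      (fun S => ⟨ψ S.toRightᶜ, φ S.toLeft, hB _ _⟩)
      (fun S T h => by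
        have e1 := compl_injective (ψ.injective (congrArg BooleanPair.lo h))
        have e2 := φ.injective (congrArg BooleanPair.hi h)
        rw [← Finset.toLeft_disjSum_toRight (u := S), ← Finset.toLeft_disjSum_toRight (u := T),
          e1, e2])
      (fun S i hi => by
        rcases i with i | i
        · refine Or.inl ⟨?_, ?_⟩
          · simp
          · simp only [Finset.toLeft_insert_inl]
            exact hφ _ i (by simpa using hi)
        · refine Or.inr ⟨?_, ?_⟩
          · simp
          · simp only [Finset.toRight_insert_inr]
            have hi' : i ∉ S.toRight := by simpa using hi
            have h1 : S.toRightᶜ = insert i (insert i S.toRight)ᶜ := by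
              ext x
              simp only [Finset.mem_compl, Finset.mem_insert]
              by_cases hx : x = i
              · simp [hx, hi']
              · simp [hx]
            rw [h1]
            exact hψ _ i (by simp))
    have e1 : (⟨ψ (∅ : Finset (Fin n ⊕ Fin m)).toRightᶜ, φ (∅ : Finset (Fin n ⊕ Fin m)).toLeft,
        hB _ _⟩ : Γ.BooleanPair) = Γ.diag r := by
      have e3 : (∅ : Finset (Fin n ⊕ Fin m)).toRight = ∅ := by ext; simp
      have e4 : (∅ : Finset (Fin n ⊕ Fin m)).toLeft = ∅ := by ext; simp
      ext
      · simpa only [diag, e3, Finset.compl_empty] using hψ1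
      · simpa only [diag, e4] using hφ0
    have e2 : (⟨ψ (Finset.univ : Finset (Fin n ⊕ Fin m)).toRightᶜ,
        φ (Finset.univ : Finset (Fin n ⊕ Fin m)).toLeft, hB _ _⟩ : Γ.BooleanPair) = b := by
      have e3 : (Finset.univ : Finset (Fin n ⊕ Fin m)).toRight = Finset.univ := by ext; simp
      have e4 : (Finset.univ : Finset (Fin n ⊕ Fin m)).toLeft = Finset.univ := by ext; simp
      ext
      · simpa [e3] using hψ0
      · simpa [e4] using hφ1
    rw [e1, e2] at this
    exact this

/-- The element of the neighborhood semilattice given by a Boolean pair around `r`. -/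
def neighborhoodMk {r lo hi : V} (h : Γ.IsBoolean lo hi) (h1 : Γ.Precedes lo r)
    (h2 : Γ.Precedes r hi) : Γ.NeighborhoodSemilattice r :=
  ⟨⟨lo, hi, h⟩, hΓ.mem_subdivision_upper_iff.2 ⟨h1, h2⟩⟩

theorem lo_precedes {r : V} (x : Γ.NeighborhoodSemilattice r) : Γ.Precedes x.1.lo r :=
  (hΓ.mem_subdivision_upper_iff.1 x.2).1

theorem precedes_hi {r : V} (x : Γ.NeighborhoodSemilattice r) : Γ.Precedes r x.1.hi :=
  (hΓ.mem_subdivision_upper_iff.1 x.2).2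

theorem neighborhood_le_iff {r : V} {x y : Γ.NeighborhoodSemilattice r} :
    x ≤ y ↔ Γ.Precedes y.1.lo x.1.lo ∧ Γ.Precedes x.1.hi y.1.hi :=
  hΓ.subdivision_precedes_iff

theorem exists_neighborhood_inf {r : V} (x y : Γ.NeighborhoodSemilattice r) :
    ∃ m : Γ.NeighborhoodSemilattice r, Γ.IsMeet r x.1.hi y.1.hi m.1.hi ∧
      Γ.reverse.IsMeet r x.1.lo y.1.lo m.1.lo := by
  obtain ⟨a, ha, -⟩ := hΓ.exists_isMeet (hΓ.precedes_hi x) (hΓ.precedes_hi y)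
  obtain ⟨b, hb, -⟩ := hΓ.reverse.exists_isMeet (precedes_reverse.2 (hΓ.lo_precedes x))
    (precedes_reverse.2 (hΓ.lo_precedes y))
  have hbr := precedes_reverse.1 hb.base
  exact ⟨hΓ.neighborhoodMk (hΓ.isBoolean_mono x.1.isBoolean (precedes_reverse.1 hb.left)
    (hbr.trans ha.base) ha.left) hbr ha.base, ha, hb⟩

/-- The neighborhood semilattice is a meet-semilattice. -/
@[reducible]
noncomputable def neighborhoodSemilatticeInf (r : V) :
    SemilatticeInf (Γ.NeighborhoodSemilattice r) where
  le_antisymm x y h h' := by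
    rw [hΓ.neighborhood_le_iff] at h h'
    exact Subtype.ext (BooleanPair.ext (hΓ.antisymm h'.1 h.1) (hΓ.antisymm h.2 h'.2))
  inf x y := (hΓ.exists_neighborhood_inf x y).choose
  inf_le_left x y := by
    obtain ⟨h1, h2⟩ := (hΓ.exists_neighborhood_inf x y).choose_spec
    exact hΓ.neighborhood_le_iff.2 ⟨precedes_reverse.1 h2.left, h1.left⟩
  inf_le_right x y := by
    obtain ⟨h1, h2⟩ := (hΓ.exists_neighborhood_inf x y).choose_spec
    exact hΓ.neighborhood_le_iff.2 ⟨precedes_reverse.1 h2.right, h1.right⟩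
  le_inf x y z hxy hxz := by
    obtain ⟨h1, h2⟩ := (hΓ.exists_neighborhood_inf y z).choose_spec
    rw [hΓ.neighborhood_le_iff] at hxy hxz
    exact hΓ.neighborhood_le_iff.2 ⟨precedes_reverse.1 (h2.greatest x.1.lo
      (precedes_reverse.2 (hΓ.lo_precedes x)) (precedes_reverse.2 hxy.1)
      (precedes_reverse.2 hxz.1)), h1.greatest x.1.hi (hΓ.precedes_hi x) hxy.2 hxz.2⟩

/-- The lower end of a join of three Boolean pairs is Boolean below their common element. -/
theorem isBoolean_of_three_lower {p b₁ b₂ b₃ b c₁ q₁ c₂ q₂ : V} (hp : Γ.Precedes b₁ p)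
    (h1 : Γ.IsBoolean c₁ q₁) (h11 : Γ.Precedes c₁ b₁) (h12 : Γ.Precedes c₁ b₂)
    (hp1 : Γ.Precedes p q₁) (h2 : Γ.IsBoolean c₂ q₂) (h21 : Γ.Precedes c₂ b₁)
    (h23 : Γ.Precedes c₂ b₃) (hp2 : Γ.Precedes p q₂)
    {r : V} (hr1 : Γ.Precedes b₁ r) (hr2 : Γ.Precedes b₂ r) (hr3 : Γ.Precedes b₃ r)
    (hb1 : Γ.Precedes b b₁) (hb2 : Γ.Precedes b b₂) (hb3 : Γ.Precedes b b₃)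
    (hb : ∀ u, Γ.Precedes u b₁ → Γ.Precedes u b₂ → Γ.Precedes u b₃ → Γ.Precedes u b) :
    Γ.IsBoolean b p := by
  obtain ⟨m, hm⟩ := hΓ.reverse.exists_isJoin (precedes_reverse.2 hr1) (precedes_reverse.2 hr2)
    (precedes_reverse.2 h11) (precedes_reverse.2 h12)
  obtain ⟨n, hn⟩ := hΓ.reverse.exists_isJoin (precedes_reverse.2 hr1) (precedes_reverse.2 hr3)
    (precedes_reverse.2 h21) (precedes_reverse.2 h23)
  have hm1 := precedes_reverse.1 hm.left
  have hn1 := precedes_reverse.1 hn.left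
  have hcm := precedes_reverse.1 (hm.least c₁ (precedes_reverse.2 h11) (precedes_reverse.2 h12))
  have hcn := precedes_reverse.1 (hn.least c₂ (precedes_reverse.2 h21) (precedes_reverse.2 h23))
  -- In the order of Γ, m is the meet of b₁, b₂ and n that of b₁, b₃. Each is Boolean below p by
  -- heredity, and b is their meet.
  refine hΓ.isBoolean_isJoin_reverse (hΓ.isBoolean_mono h1 hcm (hm1.trans hp) hp1)
    (hΓ.isBoolean_mono h2 hcn (hn1.trans hp) hp2)
    ⟨hm.least b (precedes_reverse.2 hb1) (precedes_reverse.2 hb2),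
      hn.least b (precedes_reverse.2 hb1) (precedes_reverse.2 hb3), fun u hum hun => ?_⟩
  rw [precedes_reverse] at hum hun ⊢
  exact hb u (hum.trans hm1) (hum.trans (precedes_reverse.1 hm.right))
    (hun.trans (precedes_reverse.1 hn.right))

/-- The bound has the join of the upper ends and the meet b of the lower ends. It is Boolean because
b is Boolean below each upper end separately, and Boolean pairs over the same b are closed under
joins. -/
theorem neighborhood_triple {r : V} {x y z u v w : Γ.NeighborhoodSemilattice r} (hxu : x ≤ u)
    (hyu : y ≤ u) (hxv : x ≤ v) (hzv : z ≤ v) (hyw : y ≤ w) (hzw : z ≤ w) :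
    ∃ s, x ≤ s ∧ y ≤ s ∧ z ≤ s := by
  simp only [hΓ.neighborhood_le_iff] at *
  obtain ⟨A, hA1, hA2, hA3⟩ := hΓ.exists_upper_of_triple hxu.2 hyu.2 hxv.2 hzv.2 hyw.2 hzw.2
  obtain ⟨B, hB1, hB2, hB3⟩ := hΓ.reverse.exists_upper_of_triple
    (precedes_reverse.2 hxu.1) (precedes_reverse.2 hyu.1) (precedes_reverse.2 hxv.1)
    (precedes_reverse.2 hzv.1) (precedes_reverse.2 hyw.1) (precedes_reverse.2 hzw.1)
  obtain ⟨m, a, hm, ha⟩ := hΓ.exists_isJoin_three (hΓ.precedes_hi x) (hΓ.precedes_hi y)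
    (hΓ.precedes_hi z) hA1 hA2 hA3
  have hlx := hΓ.lo_precedes x
  have hly := hΓ.lo_precedes y
  have hlz := hΓ.lo_precedes z
  obtain ⟨n, b, hn, hb⟩ := hΓ.reverse.exists_isJoin_three (precedes_reverse.2 hlx)
    (precedes_reverse.2 hly) (precedes_reverse.2 hlz) hB1 hB2 hB3
  have hbx := precedes_reverse.1 (hn.left.trans hb.left)
  have hby := precedes_reverse.1 (hn.right.trans hb.left)
  have hbz := precedes_reverse.1 hb.right
  have hbest : ∀ c, Γ.Precedes c x.1.lo → Γ.Precedes c y.1.lo → Γ.Precedes c z.1.lo →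
      Γ.Precedes c b := fun c h1 h2 h3 => precedes_reverse.1 (hb.least c
        (hn.least c (precedes_reverse.2 h1) (precedes_reverse.2 h2)) (precedes_reverse.2 h3))
  have hBx : Γ.IsBoolean b x.1.hi := hΓ.isBoolean_of_three_lower
    x.1.isBoolean.precedes u.1.isBoolean hxu.1 hyu.1 hxu.2 v.1.isBoolean hxv.1 hzv.1 hxv.2
    hlx hly hlz hbx hby hbz hbest
  have hBy : Γ.IsBoolean b y.1.hi := hΓ.isBoolean_of_three_lower
    y.1.isBoolean.precedes u.1.isBoolean hyu.1 hxu.1 hyu.2 w.1.isBoolean hyw.1 hzw.1 hyw.2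
    hly hlx hlz hby hbx hbz fun c h1 h2 h3 => hbest c h2 h1 h3
  have hBz : Γ.IsBoolean b z.1.hi := hΓ.isBoolean_of_three_lower
    z.1.isBoolean.precedes v.1.isBoolean hzv.1 hxv.1 hzv.2 w.1.isBoolean hzw.1 hyw.1 hzw.2
    hlz hlx hly hbz hbx hby fun c h1 h2 h3 => hbest c h2 h3 h1
  have hBa := hΓ.isBoolean_isJoin (hΓ.isBoolean_isJoin hBx hBy hm) hBz ha
  have hxa := hm.left.trans ha.left
  refine ⟨hΓ.neighborhoodMk hBa (hbx.trans hlx) ((hΓ.precedes_hi x).trans hxa), ?_, ?_, ?_⟩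
  · exact ⟨hbx, hxa⟩
  · exact ⟨hby, hm.right.trans ha.left⟩
  · exact ⟨hbz, ha.right⟩

/-- Order and valuation split into upper ends in Γ and lower ends in the reversed complex, so each
axiom is the average of a statement and its dual. -/
theorem isModularValuation (r : V) :
    @IsModularValuation _ (hΓ.neighborhoodSemilatticeInf r) (Γ.neighborhoodValuation r) := by
  let _ := hΓ.neighborhoodSemilatticeInf r
  refine ⟨fun x y hxy => ?_, fun x y w hxw hyw => ?_, ?_⟩
  · obtain ⟨h1, h2⟩ := hΓ.neighborhood_le_iff.1 hxy.le
    obtain ⟨k1, k1'⟩ := hΓ.weightedDist_le_of_precedes (hΓ.precedes_hi x) h2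
    obtain ⟨k2, k2'⟩ := hΓ.reverse.weightedDist_le_of_precedes
      (precedes_reverse.2 (hΓ.lo_precedes x)) (precedes_reverse.2 h1)
    change Γ.graph.weightedDist Γ.len r _ ≤ Γ.graph.weightedDist Γ.len r _ at k2
    change _ → Γ.graph.weightedDist Γ.len r _ < Γ.graph.weightedDist Γ.len r _ at k2'
    rw [hΓ.neighborhoodValuation_eq, hΓ.neighborhoodValuation_eq]
    by_cases hhi : x.1.hi = y.1.hi
    · by_cases hlo : x.1.lo = y.1.lo
      · exact absurd (Subtype.ext (BooleanPair.ext hlo hhi)) hxy.ne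
      · linarith [k2' hlo]
    · linarith [k1' hhi]
  · have hx := hΓ.neighborhood_le_iff.1 hxw
    have hy := hΓ.neighborhood_le_iff.1 hyw
    obtain ⟨a, ha⟩ := hΓ.exists_isJoin (hΓ.precedes_hi x) (hΓ.precedes_hi y) hx.2 hy.2
    obtain ⟨b, hb⟩ := hΓ.reverse.exists_isJoin (precedes_reverse.2 (hΓ.lo_precedes x))
      (precedes_reverse.2 (hΓ.lo_precedes y)) (precedes_reverse.2 hx.1) (precedes_reverse.2 hy.1)
    have hbx := precedes_reverse.1 hb.left
    have hby := precedes_reverse.1 hb.right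
    have hbr := hbx.trans (hΓ.lo_precedes x)
    have hra := (hΓ.precedes_hi x).trans ha.left
    have hB : Γ.IsBoolean b a := hΓ.isBoolean_mono w.1.isBoolean
      (precedes_reverse.1 (hb.least _ (precedes_reverse.2 hx.1) (precedes_reverse.2 hy.1)))
      (hbr.trans hra) (ha.least _ hx.2 hy.2)
    refine ⟨hΓ.neighborhoodMk hB hbr hra, ⟨?_, ?_⟩, ?_⟩
    · rintro _ (rfl | rfl)
      · exact hΓ.neighborhood_le_iff.2 ⟨hbx, ha.left⟩
      · exact hΓ.neighborhood_le_iff.2 ⟨hby, ha.right⟩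
    · intro u hu
      have h1 := hΓ.neighborhood_le_iff.1 (hu (Set.mem_insert _ _))
      have h2 := hΓ.neighborhood_le_iff.1 (hu (Set.mem_insert_of_mem _ (Set.mem_singleton _)))
      exact hΓ.neighborhood_le_iff.2 ⟨precedes_reverse.1 (hb.least _ (precedes_reverse.2 h1.1)
        (precedes_reverse.2 h2.1)), ha.least _ h1.2 h2.2⟩
    · obtain ⟨h1, h2⟩ := (hΓ.exists_neighborhood_inf x y).choose_spec
      have e1 := hΓ.weightedDist_join_add_meet ha h1
      have e2 := hΓ.reverse.weightedDist_join_add_meet hb h2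
      change Γ.graph.weightedDist Γ.len r _ + Γ.graph.weightedDist Γ.len r _ =
        Γ.graph.weightedDist Γ.len r _ + Γ.graph.weightedDist Γ.len r _ at e2
      simp only [hΓ.neighborhoodValuation_eq]
      change (Γ.graph.weightedDist Γ.len r a + Γ.graph.weightedDist Γ.len r b) / 2 +
        (Γ.graph.weightedDist Γ.len r (hΓ.exists_neighborhood_inf x y).choose.1.hi +
          Γ.graph.weightedDist Γ.len r (hΓ.exists_neighborhood_inf x y).choose.1.lo) / 2 = _
      linarith
  · rintro x y z ⟨u, hxu, hyu⟩ ⟨v, hxv, hzv⟩ ⟨w, hyw, hzw⟩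
    exact hΓ.neighborhood_triple hxu hyu hxv hzv hyw hzw

end IsModularComplex

end OrientedLengthGraph

/-! ### The optimality criterion -/

namespace OrientedLengthGraph

variable {V : Type*} {Γ : OrientedLengthGraph V}

/-- `p ⊑ q` or `q ⊑ p`. -/
def BooleanComparable (Γ : OrientedLengthGraph V) (p q : V) : Prop :=
  Γ.IsBoolean p q ∨ Γ.IsBoolean q p

theorem BooleanComparable.symm {p q : V} (h : Γ.BooleanComparable p q) :
    Γ.BooleanComparable q p := Or.symm h

theorem BooleanComparable.refl (p : V) : Γ.BooleanComparable p p := Or.inl (Γ.isBoolean_self p)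

/-- One step between comparable vertices into the strict sublevel set of `α`. -/
def StepLT (Γ : OrientedLengthGraph V) (g : V → ℝ) (α : ℝ) (a b : V) : Prop :=
  Γ.BooleanComparable a b ∧ g b < α

theorem reflTransGen_stepLT_symm {g : V → ℝ} {α : ℝ} {a b : V} (ha : g a < α)
    (h : Relation.ReflTransGen (Γ.StepLT g α) a b) :
    Relation.ReflTransGen (Γ.StepLT g α) b a := by
  induction h using Relation.ReflTransGen.head_induction_on with
  | refl => exact .refl
  | head h1 _ ih => exact (ih h1.2).tail ⟨h1.1.symm, ha⟩

namespace IsModularComplex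

variable [Finite V] (hΓ : Γ.IsModularComplex)
include hΓ

/-- The ends of comparable elements of a neighborhood semilattice are comparable. -/
theorem booleanComparable_of_le {r : V} {x y : Γ.NeighborhoodSemilattice r} (h : x ≤ y) {c d : V}
    (hc : c = x.1.lo ∨ c = x.1.hi) (hd : d = y.1.lo ∨ d = y.1.hi) : Γ.BooleanComparable c d := by
  obtain ⟨h1, h2⟩ := hΓ.neighborhood_le_iff.1 h
  have h3 := x.1.isBoolean.precedes
  have h4 : Γ.Precedes y.1.lo c ∧ Γ.Precedes c y.1.hi := by
    rcases hc with rfl | rfl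
    · exact ⟨h1, h3.trans h2⟩
    · exact ⟨h1.trans h3, h2⟩
  rcases hd with rfl | rfl
  · exact Or.inr (hΓ.isBoolean_lower y.1.isBoolean h4.1 h4.2)
  · exact Or.inl (hΓ.isBoolean_upper y.1.isBoolean h4.1 h4.2)

/-- A vertex comparable to `r` forms with `r` an element of the neighborhood semilattice. -/
theorem exists_neighborhood_of_comparable {r s : V} (h : Γ.BooleanComparable r s) (g : V → ℝ) :
    ∃ x : Γ.NeighborhoodSemilattice r, (∀ c, c = x.1.lo ∨ c = x.1.hi → c = r ∨ c = s) ∧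
      (s = x.1.lo ∨ s = x.1.hi) ∧ Γ.extend g x.1 = (g r + g s) / 2 := by
  rcases h with h | h
  · exact ⟨hΓ.neighborhoodMk h (Precedes.refl r) h.precedes, fun c hc => hc, Or.inr rfl, rfl⟩
  · exact ⟨hΓ.neighborhoodMk h h.precedes (Precedes.refl r), fun c hc => hc.symm, Or.inl rfl,
      by rw [add_comm]; rfl⟩

/-- A maximum of a path of comparable vertices can be avoided. -/
theorem reflTransGen_avoid {g : V → ℝ} (hg : Γ.IsLConvex g) {r s t : V}
    (hs : Γ.BooleanComparable r s) (ht : Γ.BooleanComparable r t) (hgs : g s ≤ g r)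
    (hgt : g t < g r) : Relation.ReflTransGen (Γ.StepLT g (g r)) s t := by
  let _ := hΓ.neighborhoodSemilatticeInf r
  have : Finite Γ.BooleanPair :=
    Finite.of_injective (fun a : Γ.BooleanPair => (a.lo, a.hi)) fun a b h => by
      simp only [Prod.mk.injEq] at h
      exact BooleanPair.ext h.1 h.2
  have : Finite (Γ.NeighborhoodSemilattice r) := Subtype.finite
  obtain ⟨x, -, hx, hfx⟩ := hΓ.exists_neighborhood_of_comparable hs g
  obtain ⟨y, hy', -, hfy⟩ := hΓ.exists_neighborhood_of_comparable ht g
  have hpath := (hΓ.isModularValuation r).reflTransGen_comparable (hg r) (α := g r) x y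
    (by rw [hfx]; linarith) (by rw [hfy]; linarith)
  -- A pair whose average is below g(r) has an end below g(r), and ends of comparable pairs are
  -- Boolean-comparable. This projects the path to vertices.
  have key : ∃ c, (c = y.1.lo ∨ c = y.1.hi) ∧ Relation.ReflTransGen (Γ.StepLT g (g r)) s c := by
    clear hfy hy'
    induction hpath with
    | refl => exact ⟨s, hx, .refl⟩
    | @tail z z' _ h ih =>
      obtain ⟨c, hc, hsc⟩ := ih
      obtain ⟨hzz, hlt⟩ := h
      change (g z'.1.lo + g z'.1.hi) / 2 < g r at hlt
      obtain ⟨d, hd, hdlt⟩ : ∃ d, (d = z'.1.lo ∨ d = z'.1.hi) ∧ g d < g r := by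
        by_cases h : g z'.1.lo < g r
        · exact ⟨_, Or.inl rfl, h⟩
        · exact ⟨_, Or.inr rfl, by linarith⟩
      refine ⟨d, hd, hsc.tail ⟨?_, hdlt⟩⟩
      rcases hzz with h | h
      · exact hΓ.booleanComparable_of_le h hc hd
      · exact (hΓ.booleanComparable_of_le h hd hc).symm
  obtain ⟨c, hc, hsc⟩ := key
  -- The projected path might end at r instead of t. As r is not below its own level, the path is
  -- then trivial and s = r, which is comparable to t.
  rcases hy' c hc with rfl | rfl
  · rcases Relation.ReflTransGen.cases_tail hsc with rfl | ⟨b, -, -, hb⟩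
    · exact .single ⟨ht, hgt⟩
    · exact absurd hb (lt_irrefl _)
  · exact hsc

/-- Sublevel sets are reached from within strict sublevel sets. -/
theorem exists_reflTransGen_stepLT {g : V → ℝ} (hg : Γ.IsLConvex g) {α : ℝ} {q r : V}
    (hq : g q < α)
    (h : Relation.ReflTransGen (fun a b => Γ.BooleanComparable a b ∧ g b ≤ α) q r) :
    ∃ t, Relation.ReflTransGen (Γ.StepLT g α) q t ∧ Γ.BooleanComparable t r ∧ g t < α := by
  have lt_of : ∀ {t}, Relation.ReflTransGen (Γ.StepLT g α) q t → g t < α := by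
    intro t ht
    rcases Relation.ReflTransGen.cases_tail ht with rfl | ⟨b, -, -, hb⟩
    · exact hq
    · exact hb
  suffices H : g r ≤ α ∧
      ∃ t, Relation.ReflTransGen (Γ.StepLT g α) q t ∧ Γ.BooleanComparable t r by
    obtain ⟨-, t, h1, h2⟩ := H
    exact ⟨t, h1, h2, lt_of h1⟩
  induction h with
  | refl => exact ⟨hq.le, q, .refl, BooleanComparable.refl q⟩
  | @tail r' r _ h ih =>
    obtain ⟨hle, t, hqt, htr⟩ := ih
    refine ⟨h.2, ?_⟩
    rcases hle.lt_or_eq with hlt | rfl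
    · exact ⟨r', hqt.tail ⟨htr, hlt⟩, h.1⟩
    -- Here r' is a peak at level α between t and r. The first vertex b of the bypass from r
    -- replaces t, and the rest of the bypass is traversed backwards.
    · have hpath := hΓ.reflTransGen_avoid hg h.1 htr.symm h.2 (lt_of hqt)
      rcases Relation.ReflTransGen.cases_head hpath with rfl | ⟨b, hb, hbt⟩
      · exact ⟨r, hqt, BooleanComparable.refl r⟩
      · exact ⟨b, hqt.trans (reflTransGen_stepLT_symm hb.2 hbt), hb.1.symm⟩

/-- Local minimality implies global minimality. -/
theorem le_of_forall_comparable {g : V → ℝ} (hg : Γ.IsLConvex g) {p : V}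
    (hp : ∀ q, Γ.BooleanComparable p q → g p ≤ g q) (q : V) : g p ≤ g q := by
  by_contra! hlt
  -- Levels are represented by vertices a, so that a least level at which q reaches p exists by
  -- finiteness.
  let A : Set V := {a | g p ≤ g a ∧
    Relation.ReflTransGen (fun b c => Γ.BooleanComparable b c ∧ g c ≤ g a) q p}
  have hA : A.Nonempty := by
    have : Nonempty V := ⟨p⟩
    obtain ⟨a, ha⟩ := Finite.exists_max g
    refine ⟨a, ha p, ?_⟩
    refine Relation.ReflTransGen.mono (fun b c hbc => ⟨?_, ha c⟩) _ _
      ((SimpleGraph.reachable_iff_reflTransGen q p).1 (hΓ.connected q p))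
    rcases (Γ.adj_iff b c).1 hbc with h | h
    · exact Or.inl (hΓ.isBoolean_of_below h)
    · exact Or.inr (hΓ.isBoolean_of_below h)
  obtain ⟨a, ⟨hpa, hqp⟩, hmin⟩ := Set.exists_min_image A g (Set.toFinite _) hA
  obtain ⟨t, hqt, htp, hgt⟩ := hΓ.exists_reflTransGen_stepLT hg (hlt.trans_le hpa) hqp
  rcases hpa.eq_or_lt with h | h
  · have := hp t htp.symm
    linarith
  -- The strict sublevel set of g(a) is the sublevel set of its largest value, which is a smaller
  -- admissible level.
  · obtain ⟨b, hb, hbmax⟩ := Set.exists_max_image {b | g b < g a} g (Set.toFinite _) ⟨p, h⟩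
    have hbA : b ∈ A := ⟨hbmax p h, Relation.ReflTransGen.mono
      (fun c d hcd => ⟨hcd.1, hbmax d hcd.2⟩) _ _ (hqt.tail ⟨htp, h⟩)⟩
    exact absurd (hmin b hbA) (not_le.2 hb)

end IsModularComplex

end OrientedLengthGraph

theorem mainTheorem6 {V : Type*} [Finite V] (Γ : OrientedLengthGraph V)
    (hΓ : Γ.IsModularComplex) (g : V → ℝ) (hg : Γ.IsLConvex g) (p : V) :
    List.TFAE [
      ∀ q : V, g p ≤ g q,
      ∀ q : V, (Γ.IsBoolean p q ∨ Γ.IsBoolean q p) → g p ≤ g q,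
      IsLeast (g '' Γ.upper p) (g p) ∧ IsLeast (g '' Γ.lower p) (g p)] := by
  tfae_have 1 → 2 := fun h q _ => h q
  tfae_have 2 → 1 := fun h q => hΓ.le_of_forall_comparable hg h q
  tfae_have 2 → 3 := by
    intro h
    refine ⟨⟨⟨p, Γ.isBoolean_self p, rfl⟩, ?_⟩, ⟨⟨p, Γ.isBoolean_self p, rfl⟩, ?_⟩⟩
    · rintro _ ⟨q, hq, rfl⟩
      exact h q (Or.inl hq)
    · rintro _ ⟨q, hq, rfl⟩
      exact h q (Or.inr hq)
  tfae_have 3 → 2 := by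
    rintro ⟨h1, h2⟩ q (hq | hq)
    · exact h1.2 ⟨q, hq, rfl⟩
    · exact h2.2 ⟨q, hq, rfl⟩
  tfae_finish
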